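/- Let $\mathcal{Q}$ be the set of $(\lambda,\mu,b,c)\in\mathbb{R}^4$ with $0<\lambda<1$, $\mu>0$, $0\le c<b\le 1$, and ($\lambda\mu\le 1$ or $\mu(1-b)\le 1-c$). For $(\lambda,\mu,b,c)\in\mathcal{Q}$ put $$d_{\lambda,\mu,b,c}=\begin{cases} b-c\lambda & \text{if } \lambda\mu<1,\\ \dfrac{(1-\lambda)(\mu b-c)}{\mu-1} & \text{if } \lambda\mu\ge 1,\end{cases}\qquad r_{\lambda,\mu}=\begin{cases}1 & \text{if }\lambda\mu<1,\\ -\dfrac{\log\lambda}{\log\mu} & \text{if }\lambda\mu\ge 1.\end{cases}$$ For $a\in(b-b\lambda,d_{\lambda,\mu,b,c})$ let $\eta=(b-a)/\lambda$ and let $f=f_{\lambda,\mu,a,b,c}\colon[0,1)\to[0,1)$ be given by $f(x)=\lambda x+a$ for $0\le x<\eta$ and $f(x)=\lambda\mu(x-\eta)+c$ for $\eta\le x<1$. Let $F\colon\mathbb{R}\to\mathbb{R}$ be the lift of $f$ given by $F(x)=\lambda x+a+(1-\lambda)\lfloor x\rfloor$ if $\{x\}<\eta$ and $F(x)=\lambda\mu(x-\eta)+c+1+(1-\lambda\mu)\lfloor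 x\rfloor$ if $\{x\}\ge\eta$. The rotation number of $f$ is $$\rho(f)=\lim_{n\to\infty}\frac{F^n(x)}{n}\pmod 1\ \in[0,1),$$ where $F^n$ is the $n$-th iterate of $F$; it is part of the statement that this limit exists for every $x\in\mathbb{R}$ and does not depend on $x$. For $0<\rho<r_{\lambda,\mu}$ put $$\sigma(\lambda,\mu,\rho)=\sum_{k\ge1}\bigl(\lfloor(k+1)\rho\rfloor-\lfloor k\rho\rfloor\bigr)\lambda^k\mu^{\lfloor k\rho\rfloor},\qquad \boldsymbol{a}(\lambda,\mu,b,c,\rho)=\frac{(1-\lambda)\bigl(b+(\mu b-c)\,\sigma(\lambda,\mu,\rho)\bigr)}{1+(\mu-1)\,\sigma(\lambda,\mu,\rho)};$$ the series converges and the denominator is nonzero. For $g=\sigma(\lambda,\mu,\cdot)$ or $g=\boldsymbol{a}(\lambda,\mu,b,c,\cdot)$ write $g(\rho^-)$ for the left limit of $g$ at $\rho$. **Theorem.** Let $(\lambda,\mu,b,c)\in\mathcal{Q}$. The function $a\mapsto\rho(f_{\lambda,\mu,a,b,c})$ is well defined, continuous and non-decreasing on $(b-b\lambda,d_{\lambda,\mu,b,c})$,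 and maps this interval onto $(0,r_{\lambda,\mu})$. Moreover, for $a\in(b-b\lambda,d_{\lambda,\mu,b,c})$: 1. For every irrational $\rho$ with $0<\rho<r_{\lambda,\mu}$, we have $\rho(f_{\lambda,\mu,a,b,c})=\rho$ if and only if $a=\boldsymbol{a}(\lambda,\mu,b,c,\rho)$. 2. For all coprime positive integers $p<q$ with $p/q<r_{\lambda,\mu}$, we have $\rho(f_{\lambda,\mu,a,b,c})=p/q$ if and only if $$\boldsymbol{a}(\lambda,\mu,b,c,(p/q)^-)\le a\le\boldsymbol{a}(\lambda,\mu,b,c,p/q).$$ Here $\lambda^q\mu^p<1$, the left limits exist, and $$\boldsymbol{a}(\lambda,\mu,b,c,(p/q)^-)=\frac{(1-\lambda)\bigl(b+(\mu b-c)\,\sigma(\lambda,\mu,(p/q)^-)\bigr)}{1+(\mu-1)\,\sigma(\lambda,\mu,(p/q)^-)},$$ with nonzero denominator, $$\sigma(\lambda,\mu,(p/q)^-)=\sigma(\lambda,\mu,p/q)-\frac{\lambda^{q-1}\mu^{p-1}(1-\lambda)}{1-\lambda^q\mu^p},$$ $$\sigma(\lambda,\mu,p/q)=\frac{1}{1-\lambda^q\mu^p}\sum_{k=1}^{q}\Bigl(\Bigl\lfloor(k+1)\frac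 pq\Bigr\rfloor-\Bigl\lfloor k\frac pq\Bigr\rfloor\Bigr)\lambda^k\mu^{\lfloor kp/q\rfloor}.$$ -/

import Mathlib

open Set Filter Topology

noncomputable section

namespace AffineCircle

/-- The set `𝒬` of admissible quadruples `(lam, mu, b, c)`. -/
def Q (lam mu b c : ℝ) : Prop :=
  0 < lam ∧ lam < 1 ∧ 0 < mu ∧ 0 ≤ c ∧ c < b ∧ b ≤ 1 ∧
    (lam * mu ≤ 1 ∨ mu * (1 - b) ≤ 1 - c)

/-- The right end point `d` of the interval of the parameter `a`. -/
def d (lam mu b c : ℝ) : ℝ :=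
  if lam * mu < 1 then b - c * lam else (1 - lam) * (mu * b - c) / (mu - 1)

/-- The break point `η`. -/
def eta (lam a b : ℝ) : ℝ := (b - a) / lam

/-- The two-branch map `f`; it is used on `[0, 1)`, which it maps into itself
(see `f_mem_Ico`). -/
def f (lam mu a b c : ℝ) (x : ℝ) : ℝ :=
  if x < eta lam a b then lam * x + a else lam * mu * (x - eta lam a b) + c

/-- The lift `F : ℝ → ℝ` of `f` (see `lift_add_one` and `fract_lift`). -/
def lift (lam mu a b c : ℝ) (x : ℝ) : ℝ :=
  if Int.fract x < eta lam a b then lam * x + a + (1 - lam) * ⌊x⌋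
  else lam * mu * (x - eta lam a b) + c + 1 + (1 - lam * mu) * ⌊x⌋

/-- The rotation number of `f`: the limit of `F^n(x) / n` modulo one, with values in `[0, 1)`.
It is written at the point `x = 0`; that the limit exists and is the same at all points `x` is
the property `HasLiftLimit`. -/
def rotationNumber (lam mu a b c : ℝ) : ℝ :=
  Int.fract (limUnder atTop fun n : ℕ => ((lift lam mu a b c)^[n] 0) / (n : ℝ))

/-- The limit of `F^n(x) / n` exists for every real `x` and does not depend on `x`. -/
def HasLiftLimit (lam mu a b c : ℝ) : Prop :=
  ∃ L : ℝ, ∀ x : ℝ,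
    Tendsto (fun n : ℕ => ((lift lam mu a b c)^[n] x) / (n : ℝ)) atTop (𝓝 L)

/-- The number `r`; the rotation numbers fill the interval `(0, r)`. -/
def r (lam mu : ℝ) : ℝ :=
  if lam * mu < 1 then 1 else -(Real.log lam / Real.log mu)

/-- The `k`-th term of the series `σ`. -/
def sigmaTerm (lam mu rho : ℝ) (k : ℕ) : ℝ :=
  ((⌊((k : ℝ) + 1) * rho⌋ - ⌊(k : ℝ) * rho⌋ : ℤ) : ℝ) * lam ^ k * mu ^ ⌊(k : ℝ) * rho⌋

/-- The series `σ = ∑_{k ≥ 1} (⌊(k+1)ρ⌋ - ⌊kρ⌋) λ^k μ^⌊kρ⌋`. -/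
def sigma (lam mu rho : ℝ) : ℝ := ∑' k : ℕ, sigmaTerm lam mu rho (k + 1)

/-- The expression `(1 - λ)(b + (μ b - c) s) / (1 + (μ - 1) s)`. -/
def aExpr (lam mu b c s : ℝ) : ℝ :=
  (1 - lam) * (b + (mu * b - c) * s) / (1 + (mu - 1) * s)

/-- The function `𝐚(λ, μ, b, c, ρ)`. -/
def aFun (lam mu b c rho : ℝ) : ℝ := aExpr lam mu b c (sigma lam mu rho)

/-- The closed form of `σ` at the rational number `p / q`. -/
def sigmaRat (lam mu : ℝ) (p q : ℕ) : ℝ :=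
  1 / (1 - lam ^ q * mu ^ p) *
    ∑ k ∈ Finset.Icc 1 q, sigmaTerm lam mu ((p : ℝ) / (q : ℝ)) k

/-- The closed form of the left limit of `σ` at the rational number `p / q`. -/
def sigmaRatLeft (lam mu : ℝ) (p q : ℕ) : ℝ :=
  sigma lam mu ((p : ℝ) / (q : ℝ)) -
    lam ^ (q - 1) * mu ^ (p - 1) * (1 - lam) / (1 - lam ^ q * mu ^ p)

/-- The closed form of the left limit of `𝐚` at the rational number `p / q`. -/
def aRatLeft (lam mu b c : ℝ) (p q : ℕ) : ℝ :=
  aExpr lam mu b c (sigmaRatLeft lam mu p q)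

/-- For admissible parameters, `f` maps `[0, 1)` into itself. -/
theorem f_mem_Ico {lam mu a b c x : ℝ} (hQ : Q lam mu b c)
    (ha : a ∈ Ioo (b - b * lam) (d lam mu b c)) (hx : x ∈ Ico (0 : ℝ) 1) :
    f lam mu a b c x ∈ Ico (0 : ℝ) 1 := by
  obtain ⟨hl0, hl1, hm, hc, hcb, hb, hor⟩ := hQ
  obtain ⟨ha1, ha2⟩ := ha
  obtain ⟨hx0, hx1⟩ := hx
  have hlm : 0 < lam * mu := mul_pos hl0 hm
  have he : lam * eta lam a b = b - a := by
    unfold eta; field_simp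
  have hbl : 0 < b * (1 - lam) := mul_pos (by linarith) (by linarith)
  unfold f
  split_ifs with h
  · constructor
    · nlinarith [mul_nonneg hl0.le hx0]
    · have := mul_lt_mul_of_pos_left h hl0
      linarith
  · push Not at h
    have h2 : 0 ≤ lam * mu * (x - eta lam a b) := mul_nonneg hlm.le (by linarith)
    refine ⟨by linarith, ?_⟩
    have h3 : lam * mu * (x - eta lam a b) = lam * mu * x - mu * (b - a) := by
      rw [← he]; ring
    have h4 : lam * mu * x < lam * mu := by nlinarith
    unfold d at ha2
    split_ifs at ha2 with hd
    · have := mul_lt_mul_of_pos_left ha2 hm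
      nlinarith
    · push Not at hd
      have hmu1 : 0 < mu - 1 := by nlinarith
      have h5 : a * (mu - 1) < (1 - lam) * (mu * b - c) := by
        rwa [lt_div_iff₀ hmu1] at ha2
      have h6 : 0 ≤ (lam * mu - 1) * ((mu * b - c) - (mu - 1)) := by
        rcases hor with h | h
        · have : lam * mu - 1 = 0 := by linarith
          simp [this]
        · exact mul_nonneg (by linarith) (by linarith)
      have h7 : (mu - 1) * (lam * mu - mu * (b - a) + c - 1) < 0 := by
        have := mul_lt_mul_of_pos_left h5 hm
        nlinarith
      have : lam * mu - mu * (b - a) + c - 1 < 0 := by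
        by_contra hcon
        push Not at hcon
        have := mul_nonneg hmu1.le hcon
        linarith
      linarith

theorem lift_add_one (lam mu a b c x : ℝ) :
    lift lam mu a b c (x + 1) = lift lam mu a b c x + 1 := by
  unfold lift
  simp only [Int.fract_add_one, Int.floor_add_one, Int.cast_add, Int.cast_one]
  split_ifs <;> ring

theorem fract_lift {lam mu a b c : ℝ} (hQ : Q lam mu b c)
    (ha : a ∈ Ioo (b - b * lam) (d lam mu b c)) (x : ℝ) :
    Int.fract (lift lam mu a b c x) = f lam mu a b c (Int.fract x) := by
  have hf := f_mem_Ico (x := Int.fract x) hQ ha ⟨Int.fract_nonneg x, Int.fract_lt_one x⟩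
  rw [Int.fract_eq_iff]
  refine ⟨hf.1, hf.2, ?_⟩
  unfold lift f
  split_ifs with h
  · refine ⟨⌊x⌋, ?_⟩
    rw [← Int.self_sub_floor]; ring
  · refine ⟨⌊x⌋ + 1, ?_⟩
    rw [← Int.self_sub_floor]; push_cast; ring

/-- If the limit exists, the rotation number is its residue modulo one, at every point. -/
theorem rotationNumber_eq {lam mu a b c x L : ℝ} (h : HasLiftLimit lam mu a b c)
    (hL : Tendsto (fun n : ℕ => ((lift lam mu a b c)^[n] x) / (n : ℝ)) atTop (𝓝 L)) :
    rotationNumber lam mu a b c = Int.fract L := by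
  obtain ⟨M, hM⟩ := h
  rw [tendsto_nhds_unique hL (hM x), rotationNumber, (hM 0).limUnder_eq]

end AffineCircle

end

/-!
The proof compares the orbits of `f` with those of the rotation by `ρ`, and reduces every question
about the parameter `a` to one about the series `σ`.

*The series.* Only the indices at which `k ↦ ⌊kρ⌋` jumps contribute to `σ`, and the `n`-th jump is
at `k = ⌈(n + 1)/ρ⌉ - 1`. Hence `σ(ρ) = ∑ λ^(⌈(n + 1)/ρ⌉ - 1) μ^n` (`Admissible.hasSum_sigmaTerm`).
In this form each exponent is monotone, continuous from the right, and has the left limit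
`⌊(n + 1)/ρ⌋`. Dominated convergence gives the left limits
`σ(ρ⁻) = ∑ λ^⌊(n + 1)/ρ⌋ μ^n`, and `σ(ρ) < σ(ρ'⁻)` for `ρ < ρ'`. Each exponent is continuous at an
irrational `ρ`; at `p / q` those with `p ∣ n + 1` drop by one, which gives the closed forms. The
intervals `[σ(ρ⁻), σ(ρ)]` with `0 < ρ < r` are disjoint and cover all levels from `0` up to the
supremum of `σ`, which is `λ / (1 - λμ)` or `∞` (`exists_sigmaLeft_le_le_sigma`).

*The parameter.* The equation `𝐚 = a` is fractional linear in `σ`, and the conditions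
`𝐚(ρ⁻) ≤ a ≤ 𝐚(ρ)` become `σ(ρ⁻) ≤ s ≤ σ(ρ)` for its solution `s = solNum / solDen`. The interval
of `a` corresponds exactly to the levels `s` just described.

*The dynamics.* Every orbit of `f` enters `[c, b)`, and there an affine change of coordinate makes
`b = 1` and `c = 0` without changing `s`; the lift is then increasing. The series
`U(y) = ∑ λ^⌊(n + y)/ρ⌋ μ^n` satisfies `U(y + ρ) = λ U(y)` and `U(y) = λ^⌊y/ρ⌋ + μ U(y + 1)`, so a
suitable affine function of `U` turns the rotation by `ρ` into the two affine branches of `f`. It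
takes values in `[0, 1]` precisely because `σ(ρ⁻) ≤ s ≤ σ(ρ)`. Since the lift is increasing, strict
inequalities with this function persist along orbits (`Matches.step`), and the orbits of the lift
stay at bounded distance from those of `x ↦ x + ρ`. Thus the rotation number is `ρ`.

*Conclusion.* The rotation number is `ρ` if and only if `𝐚(ρ⁻) ≤ a ≤ 𝐚(ρ)`
(`rotationNumber_eq_iff`). The strict order of these intervals gives monotonicity, and a monotone
function whose image is an open interval is continuous.
-/

namespace AffineCircle

variable {lam mu rho rho' a b c s : ℝ} {e e' : ℕ → ℤ}

/-! ### Sums of powers with prescribed exponents -/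

/-- The series `∑ λ^(e n) μ^n` with integer exponents `e n` of `λ`. The function `σ`, its left
limits and the function that conjugates `f` to a rotation are all of this form. -/
noncomputable def expSum (lam mu : ℝ) (e : ℕ → ℤ) : ℝ := ∑' n, lam ^ e n * mu ^ n

/-- Conditions under which the series `expSum` with exponents close to `n / ρ` converge. -/
structure Admissible (lam mu rho : ℝ) : Prop where
  lam_pos : 0 < lam
  lam_lt : lam < 1
  mu_pos : 0 < mu
  rho_pos : 0 < rho
  rho_le : rho ≤ 1
  ratio_lt : lam ^ (1 / rho) * mu < 1


theorem Admissible.summable (h : Admissible lam mu rho) (he : ∀ n : ℕ, (n : ℝ) / rho - 1 ≤ e n) :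
    Summable fun n => lam ^ e n * mu ^ n := by
  have hl := h.lam_pos
  have hm := h.mu_pos
  have hg : Summable fun n : ℕ => lam⁻¹ * (lam ^ (1 / rho) * mu) ^ n :=
    (summable_geometric_of_lt_one (by positivity) h.ratio_lt).mul_left _
  refine hg.of_nonneg_of_le (fun n => by positivity) fun n => ?_
  rw [mul_pow, ← mul_assoc]
  gcongr
  calc lam ^ e n = lam ^ (e n : ℝ) := (Real.rpow_intCast _ _).symm
    _ ≤ lam ^ ((n : ℝ) / rho - 1) := Real.rpow_le_rpow_of_exponent_ge hl h.lam_lt.le (he n)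
    _ = lam⁻¹ * (lam ^ (1 / rho)) ^ n := by
      rw [Real.rpow_sub hl, Real.rpow_one, ← Real.rpow_natCast, ← Real.rpow_mul hl.le]
      rw [div_eq_inv_mul, one_div_mul_eq_div]

theorem expSum_le (hl : 0 < lam) (hl1 : lam < 1) (hm : 0 < mu) (hee : ∀ n, e n ≤ e' n)
    (hs : Summable fun n => lam ^ e n * mu ^ n) : expSum lam mu e' ≤ expSum lam mu e := by
  have hle : ∀ n, lam ^ e' n * mu ^ n ≤ lam ^ e n * mu ^ n := fun n =>
    mul_le_mul_of_nonneg_right (zpow_le_zpow_right_of_le_one₀ hl hl1.le (hee n)) (by positivity)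
  exact (hs.of_nonneg_of_le (fun n => by positivity) hle).tsum_le_tsum hle hs

theorem expSum_lt (hl : 0 < lam) (hl1 : lam < 1) (hm : 0 < mu) (hee : ∀ n, e n ≤ e' n) {k : ℕ}
    (hk : e k < e' k) (hs : Summable fun n => lam ^ e n * mu ^ n) :
    expSum lam mu e' < expSum lam mu e := by
  have hle : ∀ n, lam ^ e' n * mu ^ n ≤ lam ^ e n * mu ^ n := fun n =>
    mul_le_mul_of_nonneg_right (zpow_le_zpow_right_of_le_one₀ hl hl1.le (hee n)) (by positivity)
  exact Summable.tsum_lt_tsum (i := k) hle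
    (mul_lt_mul_of_pos_right (zpow_lt_zpow_right_of_lt_one₀ hl hl1 hk) (by positivity))
    (hs.of_nonneg_of_le (fun n => by positivity) hle) hs

theorem expSum_pos (hl : 0 < lam) (hm : 0 < mu) (hs : Summable fun n => lam ^ e n * mu ^ n) :
    0 < expSum lam mu e :=
  hs.tsum_pos (fun n => by positivity) 0 (by positivity)

/-- For positive exponents the denominator `1 + (μ - 1) s` is positive: for `μ < 1` the sum `s`
is at most `λ / (1 - μ)`. -/
theorem one_add_mul_expSum_pos (hl : 0 < lam) (hl1 : lam < 1) (hm : 0 < mu) (he : ∀ n, 1 ≤ e n)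
    (hs : Summable fun n => lam ^ e n * mu ^ n) : 0 < 1 + (mu - 1) * expSum lam mu e := by
  rcases le_or_gt 1 mu with h | h
  · nlinarith [expSum_pos hl hm hs]
  · have hg := (hasSum_geometric_of_lt_one hm.le h).mul_left lam
    have hle : expSum lam mu e ≤ lam * (1 - mu)⁻¹ := by
      rw [← hg.tsum_eq]
      refine hs.tsum_le_tsum (fun n => ?_) hg.summable
      have := zpow_le_zpow_right_of_le_one₀ hl hl1.le (he n)
      rw [zpow_one] at this
      exact mul_le_mul_of_nonneg_right this (by positivity)
    have h1 : (1 - mu) * (lam * (1 - mu)⁻¹) = lam := by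
      have : 1 - mu ≠ 0 := by linarith
      field_simp
    nlinarith [mul_le_mul_of_nonneg_left hle (by linarith : 0 ≤ 1 - mu)]

/-- Dominated convergence for `expSum` when each exponent is eventually constant. -/
theorem tendsto_expSum {l : Filter ℝ} {E : ℝ → ℕ → ℤ} (hl : 0 < lam) (hl1 : lam < 1) (hm : 0 < mu)
    (hs : Summable fun n => lam ^ e' n * mu ^ n) (hE : ∀ n, ∀ᶠ x in l, E x n = e n)
    (hb : ∀ᶠ x in l, ∀ n, e' n ≤ E x n) :
    Tendsto (fun x => expSum lam mu (E x)) l (𝓝 (expSum lam mu e)) := by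
  refine tendsto_tsum_of_dominated_convergence hs (fun n => ?_) ?_
  · refine tendsto_const_nhds.congr' ?_
    filter_upwards [hE n] with x hx
    rw [hx]
  · filter_upwards [hb] with x hx n
    rw [Real.norm_of_nonneg (by positivity)]
    exact mul_le_mul_of_nonneg_right (zpow_le_zpow_right_of_le_one₀ hl hl1.le (hx n))
      (by positivity)

/-! ### The exponents of `σ` and of its left limits -/

/-- The position `⌈(n + 1) / ρ⌉ - 1` of the `n`-th jump of `k ↦ ⌊k ρ⌋`: the number `k` with
`k ρ < n + 1 ≤ (k + 1) ρ`. -/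
noncomputable def jump (rho : ℝ) (n : ℕ) : ℤ := ⌈((n : ℝ) + 1) / rho⌉ - 1

/-- The left limit `⌊(n + 1) / ρ⌋` of `jump` in `ρ`. -/
noncomputable def jumpLeft (rho : ℝ) (n : ℕ) : ℤ := ⌊((n : ℝ) + 1) / rho⌋

theorem le_jump (hr : 0 < rho) (n : ℕ) : (n : ℝ) / rho - 1 ≤ jump rho n := by
  have h := Int.le_ceil (((n : ℝ) + 1) / rho)
  have : (n : ℝ) / rho ≤ ((n : ℝ) + 1) / rho := by gcongr; linarith
  unfold jump
  push_cast
  linarith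

theorem le_floor_add_div (hr : 0 < rho) {y : ℝ} (hy : 0 ≤ y) (n : ℕ) :
    (n : ℝ) / rho - 1 ≤ ⌊((n : ℝ) + y) / rho⌋ := by
  have h := Int.lt_floor_add_one (((n : ℝ) + y) / rho)
  have : (n : ℝ) / rho ≤ ((n : ℝ) + y) / rho := by gcongr; linarith
  linarith

theorem Admissible.summable_jump (h : Admissible lam mu rho) :
    Summable fun n => lam ^ jump rho n * mu ^ n :=
  h.summable (le_jump h.rho_pos)

theorem Admissible.summable_jumpLeft (h : Admissible lam mu rho) :
    Summable fun n => lam ^ jumpLeft rho n * mu ^ n :=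
  h.summable (le_floor_add_div h.rho_pos zero_le_one)

theorem jumpLeft_one (n : ℕ) : jumpLeft 1 n = ((n + 1 : ℕ) : ℤ) := by
  unfold jumpLeft
  rw [div_one]
  exact_mod_cast Int.floor_natCast (R := ℝ) (n + 1)

theorem jump_le_jumpLeft (rho : ℝ) (n : ℕ) : jump rho n ≤ jumpLeft rho n := by
  have := Int.ceil_le_floor_add_one (((n : ℝ) + 1) / rho)
  unfold jump jumpLeft
  omega

theorem jumpLeft_le_jump (hr : 0 < rho) (hrr : rho < rho') (n : ℕ) :
    jumpLeft rho' n ≤ jump rho n := by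
  have h1 : ((n : ℝ) + 1) / rho' < ((n : ℝ) + 1) / rho := by gcongr
  have : ⌊((n : ℝ) + 1) / rho'⌋ < ⌈((n : ℝ) + 1) / rho⌉ :=
    Int.lt_ceil.2 ((Int.floor_le _).trans_lt h1)
  unfold jump jumpLeft
  omega

theorem exists_jumpLeft_lt_jump (hr : 0 < rho) (hrr : rho < rho') :
    ∃ n, jumpLeft rho' n < jump rho n := by
  have hr' : 0 < rho' := hr.trans hrr
  have hd : 0 < 1 / rho - 1 / rho' := sub_pos.2 (one_div_lt_one_div_of_lt hr hrr)
  obtain ⟨n, hn⟩ := exists_nat_gt (1 / (1 / rho - 1 / rho'))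
  rw [div_lt_iff₀ hd] at hn
  refine ⟨n, ?_⟩
  have h1 : ((n : ℝ) + 1) / rho' + 1 < ((n : ℝ) + 1) / rho := by
    rw [div_eq_mul_one_div, div_eq_mul_one_div _ rho]
    nlinarith
  have h2 : ⌊((n : ℝ) + 1) / rho'⌋ + 1 < ⌈((n : ℝ) + 1) / rho⌉ := by
    refine Int.lt_ceil.2 (lt_of_le_of_lt ?_ h1)
    push_cast
    linarith [Int.floor_le (((n : ℝ) + 1) / rho')]
  unfold jump jumpLeft
  omega

theorem jump_anti (hr : 0 < rho) (hrr : rho ≤ rho') (n : ℕ) : jump rho' n ≤ jump rho n := by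
  have h1 : ((n : ℝ) + 1) / rho' ≤ ((n : ℝ) + 1) / rho := by gcongr
  have := Int.ceil_le_ceil h1
  unfold jump
  omega

theorem le_jump_of_lt_one (hr : 0 < rho) (hr1 : rho < 1) (n : ℕ) : (n : ℤ) + 1 ≤ jump rho n := by
  have h1 : ((n : ℝ) + 1) < ((n : ℝ) + 1) / rho := by
    rw [lt_div_iff₀ hr]
    nlinarith [(Nat.cast_nonneg n : (0 : ℝ) ≤ n)]
  have : (n : ℤ) + 1 < ⌈((n : ℝ) + 1) / rho⌉ := Int.lt_ceil.2 (by push_cast; exact h1)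
  unfold jump
  omega

theorem one_le_jump (hr : 0 < rho) (hr1 : rho < 1) (n : ℕ) : 1 ≤ jump rho n := by
  have := le_jump_of_lt_one hr hr1 n
  omega

theorem one_le_jumpLeft (hr : 0 < rho) (hr1 : rho < 1) (n : ℕ) : 1 ≤ jumpLeft rho n :=
  (one_le_jump hr hr1 n).trans (jump_le_jumpLeft rho n)

theorem eventually_jump_eq_right (hr : 0 < rho) (n : ℕ) :
    ∀ᶠ x in 𝓝[>] rho, jump x n = jump rho n := by
  have hc : Tendsto (fun x : ℝ => ((n : ℝ) + 1) / x) (𝓝[>] rho) (𝓝 (((n : ℝ) + 1) / rho)) :=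
    (tendsto_const_nhds.div tendsto_id hr.ne').mono_left nhdsWithin_le_nhds
  have hlow : ((⌈((n : ℝ) + 1) / rho⌉ - 1 : ℤ) : ℝ) < ((n : ℝ) + 1) / rho := by
    push_cast
    linarith [Int.ceil_lt_add_one (((n : ℝ) + 1) / rho)]
  filter_upwards [hc.eventually_const_lt hlow, self_mem_nhdsWithin] with x hx hx'
  refine le_antisymm (jump_anti hr (le_of_lt hx') n) ?_
  have := Int.lt_ceil.2 hx
  unfold jump
  omega

theorem eventually_jump_eq_left (hr : 0 < rho) (n : ℕ) :
    ∀ᶠ x in 𝓝[<] rho, jump x n = jumpLeft rho n := by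
  have hc : Tendsto (fun x : ℝ => ((n : ℝ) + 1) / x) (𝓝[<] rho) (𝓝 (((n : ℝ) + 1) / rho)) :=
    (tendsto_const_nhds.div tendsto_id hr.ne').mono_left nhdsWithin_le_nhds
  have hup : ((n : ℝ) + 1) / rho < ((⌊((n : ℝ) + 1) / rho⌋ + 1 : ℤ) : ℝ) := by
    push_cast
    exact Int.lt_floor_add_one _
  filter_upwards [hc.eventually_lt_const hup, self_mem_nhdsWithin,
    (lt_mem_nhds hr).filter_mono nhdsWithin_le_nhds] with x hx hx' hx0
  refine le_antisymm ?_ (jumpLeft_le_jump hx0 hx' n)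
  have := Int.ceil_le.2 hx.le
  unfold jump jumpLeft
  omega

/-! ### The series `σ` as a sum over jumps -/

theorem floor_jump_mul (hr : 0 < rho) (hr1 : rho < 1) {n k : ℕ} (hk : (k : ℤ) = jump rho n) :
    ⌊(k : ℝ) * rho⌋ = n ∧ ⌊((k : ℝ) + 1) * rho⌋ = n + 1 := by
  have hk' : (k : ℝ) = ⌈((n : ℝ) + 1) / rho⌉ - 1 := by
    have : ((k : ℤ) : ℝ) = ((jump rho n : ℤ) : ℝ) := by rw [hk]
    unfold jump at this
    push_cast at this
    exact this
  have h1 : ((n : ℝ) + 1) / rho ≤ k + 1 := by rw [hk']; linarith [Int.le_ceil (((n : ℝ) + 1) / rho)]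
  have h2 : (k : ℝ) < ((n : ℝ) + 1) / rho := by
    rw [hk']; linarith [Int.ceil_lt_add_one (((n : ℝ) + 1) / rho)]
  rw [div_le_iff₀ hr] at h1
  rw [lt_div_iff₀ hr] at h2
  constructor
  · rw [Int.floor_eq_iff]
    push_cast
    constructor <;> nlinarith
  · rw [Int.floor_eq_iff]
    push_cast
    constructor <;> nlinarith

theorem eq_jump_of_floor_ne (hr : 0 < rho) {k : ℕ}
    (hk : ⌊((k : ℝ) + 1) * rho⌋ ≠ ⌊(k : ℝ) * rho⌋) :
    (k : ℤ) = jump rho ⌊(k : ℝ) * rho⌋.toNat := by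
  have h0 : 0 ≤ ⌊(k : ℝ) * rho⌋ := Int.floor_nonneg.2 (by positivity)
  obtain ⟨n, hn⟩ := Int.eq_ofNat_of_zero_le h0
  rw [hn] at hk ⊢
  have h1 := Int.lt_floor_add_one ((k : ℝ) * rho)
  have h2 : ⌊(k : ℝ) * rho⌋ ≤ ⌊((k : ℝ) + 1) * rho⌋ := Int.floor_le_floor (by nlinarith)
  have h3 : (n : ℤ) + 1 ≤ ⌊((k : ℝ) + 1) * rho⌋ := by omega
  have h4 := Int.le_floor.1 h3
  rw [hn] at h1
  push_cast at h1 h4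
  have : ⌈((n : ℝ) + 1) / rho⌉ = (k : ℤ) + 1 := by
    rw [Int.ceil_eq_iff]
    push_cast
    constructor
    · rw [add_sub_cancel_right, lt_div_iff₀ hr]; exact h1
    · rw [div_le_iff₀ hr]; exact h4
  simp [jump, this]

/-- Only the jumps of `k ↦ ⌊k ρ⌋` contribute to `σ`, and at the `n`-th jump the exponent of `μ`
is `n`. -/
theorem Admissible.hasSum_sigmaTerm (h : Admissible lam mu rho) (hr1 : rho < 1) :
    HasSum (fun k => sigmaTerm lam mu rho (k + 1)) (expSum lam mu (jump rho)) := by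
  have hr := h.rho_pos
  set i : ℕ → ℕ := fun n => (jump rho n).toNat - 1
  have hi : ∀ n, ((i n + 1 : ℕ) : ℤ) = jump rho n := fun n => by
    have := one_le_jump hr hr1 n
    simp only [i]
    omega
  have hinj : Function.Injective i := fun m n hmn => by
    have h1 := (floor_jump_mul hr hr1 (hi m)).1
    have h2 := (floor_jump_mul hr hr1 (hi n)).1
    rw [hmn, h2] at h1
    exact_mod_cast h1.symm
  rw [← hinj.hasSum_iff]
  · refine h.summable_jump.hasSum.congr_fun fun n => ?_
    obtain ⟨h1, h2⟩ := floor_jump_mul hr hr1 (hi n)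
    rw [Function.comp_apply, sigmaTerm, h1, h2, ← hi n, zpow_natCast, zpow_natCast]
    simp
  · intro k hk
    have : ⌊(((k + 1 : ℕ) : ℝ) + 1) * rho⌋ = ⌊((k + 1 : ℕ) : ℝ) * rho⌋ := by
      by_contra hne
      have h1 := eq_jump_of_floor_ne hr hne
      refine hk ⟨⌊((k + 1 : ℕ) : ℝ) * rho⌋.toNat, ?_⟩
      have h2 := hi ⌊((k + 1 : ℕ) : ℝ) * rho⌋.toNat
      rw [← h1] at h2
      exact_mod_cast Nat.succ_injective (by exact_mod_cast h2)
    rw [sigmaTerm, this]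
    simp

theorem Admissible.sigma_eq (h : Admissible lam mu rho) (hr1 : rho < 1) :
    sigma lam mu rho = expSum lam mu (jump rho) :=
  (h.hasSum_sigmaTerm hr1).tsum_eq

/-! ### The admissible range -/

theorem Admissible.of_lt_r (hl : 0 < lam) (hl1 : lam < 1) (hm : 0 < mu) (hr : 0 < rho)
    (hrr : rho < r lam mu) : Admissible lam mu rho ∧ rho < 1 := by
  have hlog : Real.log lam < 0 := Real.log_neg hl hl1
  unfold r at hrr
  split_ifs at hrr with hlm
  · refine ⟨⟨hl, hl1, hm, hr, hrr.le, lt_of_le_of_lt ?_ hlm⟩, hrr⟩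
    gcongr
    calc lam ^ (1 / rho) ≤ lam ^ (1 : ℝ) :=
          Real.rpow_le_rpow_of_exponent_ge hl hl1.le (one_le_one_div hr hrr.le)
      _ = lam := Real.rpow_one _
  · push Not at hlm
    have hmu : 1 < mu := by nlinarith
    have hlogm : 0 < Real.log mu := Real.log_pos hmu
    have hsum : 0 ≤ Real.log lam + Real.log mu := by
      rw [← Real.log_mul hl.ne' hm.ne']
      exact Real.log_nonneg hlm
    have h1 : rho * Real.log mu < -Real.log lam := by
      rwa [← neg_div, lt_div_iff₀ hlogm] at hrr
    have hr1 : rho < 1 := by nlinarith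
    refine ⟨⟨hl, hl1, hm, hr, hr1.le, ?_⟩, hr1⟩
    rw [← Real.log_neg_iff (by positivity), Real.log_mul (by positivity) hm.ne', Real.log_rpow hl]
    have : (1 / rho) * (Real.log lam + rho * Real.log mu) < 0 :=
      mul_neg_of_pos_of_neg (by positivity) (by linarith)
    have h2 : (1 / rho) * (Real.log lam + rho * Real.log mu) =
      1 / rho * Real.log lam + Real.log mu := by field_simp
    linarith

theorem r_pos (hl : 0 < lam) (hl1 : lam < 1) : 0 < r lam mu := by
  unfold r
  split_ifs with hlm
  · exact one_pos
  · push Not at hlm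
    have hmu : 1 < mu := by nlinarith
    have := div_neg_of_neg_of_pos (Real.log_neg hl hl1) (Real.log_pos hmu)
    linarith

theorem Admissible.sigma_lt (h : Admissible lam mu rho) (h' : Admissible lam mu rho')
    (hrr : rho < rho') : expSum lam mu (jump rho) < expSum lam mu (jumpLeft rho') := by
  obtain ⟨k, hk⟩ := exists_jumpLeft_lt_jump h.rho_pos hrr
  exact expSum_lt h.lam_pos h.lam_lt h.mu_pos (jumpLeft_le_jump h.rho_pos hrr) hk
    h'.summable_jumpLeft

theorem Admissible.tendsto_left (h : Admissible lam mu rho) :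
    Tendsto (fun x => expSum lam mu (jump x)) (𝓝[<] rho) (𝓝 (expSum lam mu (jumpLeft rho))) := by
  refine tendsto_expSum h.lam_pos h.lam_lt h.mu_pos h.summable_jump
    (eventually_jump_eq_left h.rho_pos) ?_
  filter_upwards [self_mem_nhdsWithin, (lt_mem_nhds h.rho_pos).filter_mono nhdsWithin_le_nhds]
    with x hx hx0 n
  exact jump_anti hx0 (le_of_lt hx) n

theorem Admissible.tendsto_right (h : Admissible lam mu rho) (h' : Admissible lam mu rho')
    (hrr : rho < rho') :
    Tendsto (fun x => expSum lam mu (jump x)) (𝓝[>] rho) (𝓝 (expSum lam mu (jump rho))) := by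
  refine tendsto_expSum h.lam_pos h.lam_lt h.mu_pos h'.summable_jump
    (eventually_jump_eq_right h.rho_pos) ?_
  filter_upwards [self_mem_nhdsWithin, (gt_mem_nhds hrr).filter_mono nhdsWithin_le_nhds]
    with x hx hx0 n
  exact jump_anti (h.rho_pos.trans hx) (le_of_lt hx0) n

/-- The values of `σ` come arbitrarily close to `0`. -/
theorem Admissible.exists_sigma_lt (h : Admissible lam mu rho) {s : ℝ} (hs : 0 < s) :
    ∃ x, 0 < x ∧ x < rho ∧ expSum lam mu (jump x) < s := by
  have hl := h.lam_pos
  have ht : Tendsto (fun x => expSum lam mu (jump x)) (𝓝[>] 0) (𝓝 (∑' _ : ℕ, 0)) := by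
    refine tendsto_tsum_of_dominated_convergence h.summable_jump (fun n => ?_) ?_
    · have h1 : Tendsto (fun x : ℝ => (((n : ℝ) + 1) / x)) (𝓝[>] 0) atTop :=
        tendsto_inv_nhdsGT_zero.const_mul_atTop (by positivity)
      have h2 : Tendsto (fun x : ℝ => lam ^ (((n : ℝ) + 1) / x - 1) * mu ^ n) (𝓝[>] 0) (𝓝 0) := by
        have := (tendsto_rpow_atTop_of_base_lt_one lam (by linarith) h.lam_lt).comp
          (tendsto_atTop_add_const_right _ (-1) h1)
        simpa [← sub_eq_add_neg] using this.mul_const (mu ^ n)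
      refine squeeze_zero' (Eventually.of_forall fun x => ?_) (Eventually.of_forall fun x => ?_) h2
      · have := h.mu_pos
        positivity
      · have := h.mu_pos
        gcongr
        rw [← Real.rpow_intCast]
        refine Real.rpow_le_rpow_of_exponent_ge hl h.lam_lt.le ?_
        unfold jump
        push_cast
        linarith [Int.le_ceil (((n : ℝ) + 1) / x)]
    · filter_upwards [self_mem_nhdsWithin, (gt_mem_nhds h.rho_pos).filter_mono nhdsWithin_le_nhds]
        with x hx hx0 n
      have := h.mu_pos
      rw [Real.norm_of_nonneg (by positivity)]
      exact mul_le_mul_of_nonneg_right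
        (zpow_le_zpow_right_of_le_one₀ hl h.lam_lt.le (jump_anti hx hx0.le n)) (by positivity)
  rw [tsum_zero] at ht
  obtain ⟨x, hx1, hx2, hx3⟩ := (((ht.eventually_lt_const hs).and
    (((gt_mem_nhds h.rho_pos).filter_mono nhdsWithin_le_nhds).and self_mem_nhdsWithin))).exists
  exact ⟨x, hx3, hx2, hx1⟩

/-- Any number below a finite partial sum of the left limit of `σ` at `R` is below a value of `σ`
at some `ρ < R`. The series itself may diverge at `R`. -/
theorem exists_lt_sigma {R s : ℝ} (hR : 0 < R)
    (hadm : ∀ x, 0 < x → x < R → Admissible lam mu x) {N : ℕ}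
    (hs : s < ∑ n ∈ Finset.range N, lam ^ jumpLeft R n * mu ^ n) :
    ∃ x, 0 < x ∧ x < R ∧ s < expSum lam mu (jump x) := by
  have h1 : ∀ᶠ x in 𝓝[<] R, ∀ n ∈ Finset.range N, jump x n = jumpLeft R n :=
    (Finset.eventually_all _).2 fun n _ => eventually_jump_eq_left hR n
  obtain ⟨x, hx1, hx2, hx3⟩ := (h1.and
    (((lt_mem_nhds hR).filter_mono nhdsWithin_le_nhds).and self_mem_nhdsWithin)).exists
  refine ⟨x, hx2, hx3, hs.trans_le ?_⟩
  have h := hadm x hx2 hx3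
  have hl := h.lam_pos
  have hm := h.mu_pos
  rw [Finset.sum_congr rfl fun n hn =>
    show lam ^ jumpLeft R n * mu ^ n = lam ^ jump x n * mu ^ n by rw [hx1 n hn]]
  exact h.summable_jump.sum_le_tsum _ fun n _ => by positivity

/-- At the right end of the range of rotation numbers, `σ` reaches every number below
`λ / (1 - λμ)` if `λμ < 1`, and is unbounded if `λμ ≥ 1`. -/
theorem exists_lt_sigma_of_lt_r (hl : 0 < lam) (hl1 : lam < 1) (hm : 0 < mu) {s : ℝ}
    (hs : lam * mu < 1 → s * (1 - lam * mu) < lam) :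
    ∃ x, 0 < x ∧ x < r lam mu ∧ s < expSum lam mu (jump x) := by
  have hadm : ∀ x, 0 < x → x < r lam mu → Admissible lam mu x := fun x hx hx' =>
    (Admissible.of_lt_r hl hl1 hm hx hx').1
  suffices h : ∃ N : ℕ, s < ∑ n ∈ Finset.range N, lam ^ jumpLeft (r lam mu) n * mu ^ n by
    obtain ⟨N, hN⟩ := h
    exact exists_lt_sigma (r_pos hl hl1) hadm hN
  by_cases hlm : lam * mu < 1
  · have hR : r lam mu = 1 := if_pos hlm
    have hg := (hasSum_geometric_of_lt_one (by positivity) hlm).mul_left lam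
    have hlt : s < lam * (1 - lam * mu)⁻¹ := by
      rw [← div_eq_mul_inv, lt_div_iff₀ (by linarith)]
      exact hs hlm
    obtain ⟨N, hN⟩ := (hg.tendsto_sum_nat.eventually_const_lt hlt).exists
    refine ⟨N, hN.trans_eq (Finset.sum_congr rfl fun n _ => ?_)⟩
    rw [hR, jumpLeft_one, zpow_natCast, mul_pow, pow_succ]
    ring
  · have hR : r lam mu = -(Real.log lam / Real.log mu) := if_neg hlm
    push Not at hlm
    have hmu : 1 < mu := by nlinarith
    have hlogm : 0 < Real.log mu := Real.log_pos hmu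
    have hlogl : Real.log lam < 0 := Real.log_neg hl hl1
    -- at `ρ = r` one has `λ^(1/ρ) = 1/μ`, so that every term is at least `1/μ`
    have hkey : lam ^ (1 / r lam mu) = mu⁻¹ := by
      apply Real.log_injOn_pos (Set.mem_Ioi.2 (by positivity)) (Set.mem_Ioi.2 (by positivity))
      have := hlogl.ne
      rw [Real.log_rpow hl, Real.log_inv, hR, one_div, inv_neg, inv_div]
      field_simp
    have hterm : ∀ n, mu⁻¹ ≤ lam ^ jumpLeft (r lam mu) n * mu ^ n := fun n => by
      have h1 : lam ^ (((n : ℝ) + 1) / r lam mu) ≤ lam ^ jumpLeft (r lam mu) n := by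
        rw [← Real.rpow_intCast]
        exact Real.rpow_le_rpow_of_exponent_ge hl hl1.le (Int.floor_le _)
      have h2 : lam ^ (((n : ℝ) + 1) / r lam mu) = (mu⁻¹) ^ (n + 1) := by
        rw [← hkey, ← Real.rpow_natCast, ← Real.rpow_mul hl.le]
        push_cast
        rw [one_div_mul_eq_div]
      calc mu⁻¹ = (mu⁻¹) ^ (n + 1) * mu ^ n := by
            rw [pow_succ, inv_pow]; field_simp
        _ ≤ _ := by rw [← h2]; gcongr
    obtain ⟨N, hN⟩ := exists_nat_gt (s * mu)
    refine ⟨N, lt_of_lt_of_le ?_ (Finset.card_nsmul_le_sum _ _ _ fun n _ => hterm n)⟩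
    rw [Finset.card_range, nsmul_eq_mul, ← div_eq_mul_inv, lt_div_iff₀ hm]
    exact hN

/-- Every level `s > 0` below the supremum of `σ` is a value of `σ` or lies in the gap at one of its
jumps. This uses that `σ` is monotone, continuous from the right, and has left limits. -/
theorem exists_sigmaLeft_le_le_sigma (hl : 0 < lam) (hl1 : lam < 1) (hm : 0 < mu) {s : ℝ}
    (hs0 : 0 < s) (hs : lam * mu < 1 → s * (1 - lam * mu) < lam) :
    ∃ rho, 0 < rho ∧ rho < r lam mu ∧ expSum lam mu (jumpLeft rho) ≤ s ∧
      s ≤ expSum lam mu (jump rho) := by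
  have hadm : ∀ x, 0 < x → x < r lam mu → Admissible lam mu x := fun x hx hx' =>
    (Admissible.of_lt_r hl hl1 hm hx hx').1
  obtain ⟨y, hy0, hy1, hy⟩ := exists_lt_sigma_of_lt_r hl hl1 hm hs
  obtain ⟨x, hx0, hxy, hx⟩ := (hadm y hy0 hy1).exists_sigma_lt hs0
  have hmono : ∀ u v, 0 < u → u ≤ v → v < r lam mu →
      expSum lam mu (jump u) ≤ expSum lam mu (jump v) := fun u v hu huv hv =>
    expSum_le hl hl1 hm (jump_anti hu huv) (hadm v (hu.trans_le huv) hv).summable_jump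
  set T : Set ℝ := {u | 0 < u ∧ u ≤ y ∧ expSum lam mu (jump u) ≤ s}
  have hTne : T.Nonempty := ⟨x, hx0, hxy.le, hx.le⟩
  have hTb : BddAbove T := ⟨y, fun u hu => hu.2.1⟩
  have hxR : x ≤ sSup T := le_csSup hTb ⟨hx0, hxy.le, hx.le⟩
  have hRy : sSup T ≤ y := csSup_le hTne fun u hu => hu.2.1
  have hR0 : 0 < sSup T := hx0.trans_le hxR
  have hR := hadm _ hR0 (hRy.trans_lt hy1)
  refine ⟨sSup T, hR0, hRy.trans_lt hy1, ?_, ?_⟩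
  · refine le_of_tendsto hR.tendsto_left ?_
    filter_upwards [self_mem_nhdsWithin, (lt_mem_nhds hR0).filter_mono nhdsWithin_le_nhds]
      with u hu hu0
    obtain ⟨v, hv, huv⟩ := exists_lt_of_lt_csSup hTne hu
    exact (hmono u v hu0 huv.le (hv.2.1.trans_lt hy1)).trans hv.2.2
  · rcases hRy.eq_or_lt with heq | hlt
    · rw [heq]
      exact hy.le
    · refine ge_of_tendsto (hR.tendsto_right (hadm y hy0 hy1) hlt) ?_
      filter_upwards [self_mem_nhdsWithin, (gt_mem_nhds hlt).filter_mono nhdsWithin_le_nhds]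
        with u hu huy
      by_contra hcon
      exact absurd (le_csSup hTb ⟨hR0.trans hu, huy.le, (not_le.1 hcon).le⟩) (not_le.2 hu)

/-! ### Closed forms at rational numbers -/

theorem Admissible.pow_mul_pow_lt_one {p q : ℕ} (hp : 0 < p) (hq : 0 < q)
    (h : Admissible lam mu ((p : ℝ) / q)) : lam ^ q * mu ^ p < 1 := by
  have hl := h.lam_pos
  have hm := h.mu_pos
  have h1 : (lam ^ (1 / ((p : ℝ) / q)) * mu) ^ p = lam ^ q * mu ^ p := by
    have hp' : (p : ℝ) ≠ 0 := by positivity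
    have hq' : (q : ℝ) ≠ 0 := by positivity
    rw [mul_pow, ← Real.rpow_natCast (lam ^ (1 / ((p : ℝ) / q))), ← Real.rpow_mul hl.le,
      ← Real.rpow_natCast lam q]
    congr 2
    field_simp
  rw [← h1]
  exact pow_lt_one₀ (by positivity) h.ratio_lt hp.ne'

theorem sigmaTerm_add_period (hm : 0 < mu) {p q : ℕ} (hq : 0 < q) (k : ℕ) :
    sigmaTerm lam mu ((p : ℝ) / q) (k + q) =
      lam ^ q * mu ^ p * sigmaTerm lam mu ((p : ℝ) / q) k := by
  have hq' : (q : ℝ) ≠ 0 := by positivity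
  have h1 : ((k + q : ℕ) : ℝ) * ((p : ℝ) / q) = k * ((p : ℝ) / q) + (p : ℤ) := by
    push_cast; field_simp
  have h2 : (((k + q : ℕ) : ℝ) + 1) * ((p : ℝ) / q) = (k + 1) * ((p : ℝ) / q) + (p : ℤ) := by
    push_cast; field_simp; ring
  unfold sigmaTerm
  rw [h1, h2, Int.floor_add_intCast, Int.floor_add_intCast, zpow_add₀ hm.ne', zpow_natCast, pow_add]
  push_cast
  ring

theorem Admissible.sigma_eq_sigmaRat {p q : ℕ} (hp : 0 < p) (hpq : p < q)
    (h : Admissible lam mu ((p : ℝ) / q)) :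
    sigma lam mu ((p : ℝ) / q) = sigmaRat lam mu p q := by
  have hq : 0 < q := hp.trans hpq
  have hr1 : (p : ℝ) / q < 1 := by
    rw [div_lt_one (by positivity)]
    exact_mod_cast hpq
  have hs := (h.hasSum_sigmaTerm hr1).summable
  have h1 := hs.sum_add_tsum_nat_add q
  have h2 : ∀ k, sigmaTerm lam mu ((p : ℝ) / q) (k + q + 1) =
      lam ^ q * mu ^ p * sigmaTerm lam mu ((p : ℝ) / q) (k + 1) := fun k => by
    rw [← sigmaTerm_add_period h.mu_pos hq, add_right_comm]
  simp only [h2, tsum_mul_left] at h1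
  have h3 : ∑ k ∈ Finset.Icc 1 q, sigmaTerm lam mu ((p : ℝ) / q) k =
      ∑ k ∈ Finset.range q, sigmaTerm lam mu ((p : ℝ) / q) (k + 1) := by
    rw [Finset.range_eq_Ico, Finset.sum_Ico_add' (sigmaTerm lam mu ((p : ℝ) / q)) 0 q 1, zero_add]
    rfl
  have h4 := h.pow_mul_pow_lt_one hp hq
  have h5 : 1 - lam ^ q * mu ^ p ≠ 0 := by linarith
  unfold sigmaRat
  rw [h3, one_div, eq_inv_mul_iff_mul_eq₀ h5]
  unfold sigma
  linarith

/-- At `p / q` the jumps number `p, 2p, 3p, …` move by one; the geometric series of these changes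
is the jump of `σ` at `p / q`. -/
theorem Admissible.sigmaRatLeft_eq {p q : ℕ} (hp : 0 < p) (hpq : p < q) (hcop : Nat.Coprime p q)
    (h : Admissible lam mu ((p : ℝ) / q)) :
    sigmaRatLeft lam mu p q = expSum lam mu (jumpLeft ((p : ℝ) / q)) := by
  have hq : 0 < q := hp.trans hpq
  have hp' : (p : ℝ) ≠ 0 := by positivity
  have hq' : (q : ℝ) ≠ 0 := by positivity
  have hl := h.lam_pos
  have hm := h.mu_pos
  have hr1 : (p : ℝ) / q < 1 := by
    rw [div_lt_one (by positivity)]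
    exact_mod_cast hpq
  set i : ℕ → ℕ := fun j => (j + 1) * p - 1
  have hi : ∀ j, i j + 1 = (j + 1) * p := fun j =>
    Nat.sub_add_cancel (Nat.mul_pos j.succ_pos hp)
  have hinj : Function.Injective i := fun j j' hjj => by
    have h1 := hi j
    rw [hjj, hi j'] at h1
    have := Nat.eq_of_mul_eq_mul_right hp h1
    omega
  have hdiv : ∀ j, ((i j : ℝ) + 1) / ((p : ℝ) / q) = (((j + 1) * q : ℕ) : ℝ) := fun j => by
    have : (i j : ℝ) + 1 = (j + 1) * p := by exact_mod_cast hi j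
    rw [this]
    push_cast
    field_simp
  have hdiff : HasSum (fun n => lam ^ jump ((p : ℝ) / q) n * mu ^ n -
      lam ^ jumpLeft ((p : ℝ) / q) n * mu ^ n)
      (lam ^ (q - 1) * mu ^ (p - 1) * (1 - lam) * (1 - lam ^ q * mu ^ p)⁻¹) := by
    rw [← hinj.hasSum_iff]
    · refine ((hasSum_geometric_of_lt_one (by positivity)
        (h.pow_mul_pow_lt_one hp hq)).mul_left _).congr_fun fun j => ?_
      have e1 : jump ((p : ℝ) / q) (i j) = ((j * q + (q - 1) : ℕ) : ℤ) := by
        unfold jump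
        rw [hdiv, Int.ceil_natCast]
        push_cast [Nat.cast_sub (show 1 ≤ q from hq)]
        ring
      have e2 : jumpLeft ((p : ℝ) / q) (i j) = ((j * q + (q - 1) + 1 : ℕ) : ℤ) := by
        unfold jumpLeft
        rw [hdiv, Int.floor_natCast]
        push_cast [Nat.cast_sub (show 1 ≤ q from hq)]
        ring
      have e3 : i j = j * p + (p - 1) := by
        have h1 := hi j
        rw [add_mul, one_mul] at h1
        omega
      rw [Function.comp_apply, e1, e2, zpow_natCast, zpow_natCast, e3]
      simp only [pow_add, pow_mul', mul_pow, pow_one]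
      ring
    · intro n hn
      suffices hjj : jump ((p : ℝ) / q) n = jumpLeft ((p : ℝ) / q) n by rw [hjj, sub_self]
      refine le_antisymm (jump_le_jumpLeft _ n) ?_
      by_contra hcon
      have h1 : ⌈((n : ℝ) + 1) / ((p : ℝ) / q)⌉ ≤ ⌊((n : ℝ) + 1) / ((p : ℝ) / q)⌋ := by
        unfold jump jumpLeft at hcon
        omega
      have h2 : ((n : ℝ) + 1) / ((p : ℝ) / q) = ⌊((n : ℝ) + 1) / ((p : ℝ) / q)⌋ :=
        le_antisymm ((Int.le_ceil _).trans (by exact_mod_cast h1)) (Int.floor_le _)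
      set m := ⌊((n : ℝ) + 1) / ((p : ℝ) / q)⌋
      have h3 : ((n : ℝ) + 1) * q = m * p := by
        rw [← h2]; field_simp
      have h4 : ((n : ℤ) + 1) * q = m * p := by exact_mod_cast h3
      have h5 : (p : ℤ) ∣ ((n + 1 : ℕ) : ℤ) * q := ⟨m, by push_cast; rw [h4, mul_comm]⟩
      have h6 : p ∣ n + 1 := hcop.dvd_of_dvd_mul_right (by exact_mod_cast h5)
      obtain ⟨j, hj⟩ := h6
      have hj0 : 0 < j := Nat.pos_of_ne_zero fun h0 => by simp [h0] at hj
      refine hn ⟨j - 1, ?_⟩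
      have := hi (j - 1)
      rw [Nat.sub_add_cancel hj0, mul_comm, ← hj] at this
      omega
  have h1 := hdiff.unique (h.summable_jump.hasSum.sub h.summable_jumpLeft.hasSum)
  unfold sigmaRatLeft
  rw [h.sigma_eq hr1, div_eq_mul_inv (lam ^ (q - 1) * _ * _), h1]
  unfold expSum
  ring

/-! ### The parameter `a` as a function of `σ` -/

/-- The numerator of the solution `s` of `aExpr s = a`. -/
def solNum (lam a b : ℝ) : ℝ := a - (1 - lam) * b

/-- The denominator of the solution `s` of `aExpr s = a`. -/
def solDen (lam mu a b c : ℝ) : ℝ := (1 - lam) * (mu * b - c) - (mu - 1) * a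

theorem aExpr_le_iff (hs : 0 < 1 + (mu - 1) * s) :
    aExpr lam mu b c s ≤ a ↔ s * solDen lam mu a b c ≤ solNum lam a b := by
  unfold aExpr solDen solNum
  rw [div_le_iff₀ hs]
  constructor <;> intro h <;> nlinarith

theorem le_aExpr_iff (hs : 0 < 1 + (mu - 1) * s) :
    a ≤ aExpr lam mu b c s ↔ solNum lam a b ≤ s * solDen lam mu a b c := by
  unfold aExpr solDen solNum
  rw [le_div_iff₀ hs]
  constructor <;> intro h <;> nlinarith

theorem aExpr_lt_aExpr {t : ℝ} (hl1 : lam < 1) (hcb : c < b) (hs : 0 < 1 + (mu - 1) * s)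
    (ht : 0 < 1 + (mu - 1) * t) (hst : s < t) : aExpr lam mu b c s < aExpr lam mu b c t := by
  unfold aExpr
  rw [div_lt_div_iff₀ hs ht]
  have : 0 < (1 - lam) * (b - c) * (t - s) :=
    mul_pos (mul_pos (by linarith) (by linarith)) (by linarith)
  nlinarith

theorem tendsto_aExpr {l : Filter ℝ} {g : ℝ → ℝ} (hs : 1 + (mu - 1) * s ≠ 0)
    (hg : Tendsto g l (𝓝 s)) :
    Tendsto (fun x => aExpr lam mu b c (g x)) l (𝓝 (aExpr lam mu b c s)) :=
  ((((hg.const_mul _).const_add _).const_mul _)).div ((hg.const_mul _).const_add _) hs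

theorem lt_of_mem_Ioo (hQ : Q lam mu b c) (ha : a ∈ Ioo (b - b * lam) (d lam mu b c)) :
    a < b - c * lam := by
  obtain ⟨hl0, hl1, hm, hc, hcb, hb, -⟩ := hQ
  have ha2 := ha.2
  unfold d at ha2
  split_ifs at ha2 with hlm
  · exact ha2
  · push Not at hlm
    have hmu : 0 < mu - 1 := by nlinarith
    rw [lt_div_iff₀ hmu] at ha2
    have h1 : 0 ≤ (lam * mu - 1) * (b - c) := mul_nonneg (by linarith) (by linarith)
    by_contra hcon
    push Not at hcon
    nlinarith [mul_le_mul_of_nonneg_right hcon hmu.le]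

theorem solNum_pos (ha : a ∈ Ioo (b - b * lam) (d lam mu b c)) : 0 < solNum lam a b := by
  have := ha.1
  unfold solNum
  linarith

theorem solDen_pos (hQ : Q lam mu b c) (ha : a ∈ Ioo (b - b * lam) (d lam mu b c)) :
    0 < solDen lam mu a b c := by
  have ha3 := lt_of_mem_Ioo hQ ha
  obtain ⟨hl0, hl1, hm, hc, hcb, hb, -⟩ := hQ
  obtain ⟨ha1, ha2⟩ := ha
  unfold solDen
  unfold d at ha2
  split_ifs at ha2 with hlm
  · have h0 : 0 < (1 - lam * mu) * (b - c) := mul_pos (by linarith) (by linarith)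
    rcases le_or_gt 1 mu with h | h
    · nlinarith [mul_le_mul_of_nonneg_right ha3.le (by linarith : 0 ≤ mu - 1)]
    · have h1 := mul_lt_mul_of_pos_right ha1 (by linarith : 0 < 1 - mu)
      have h2 : 0 < (1 - lam) * (b - c) := mul_pos (by linarith) (by linarith)
      nlinarith
  · push Not at hlm
    have hmu : 0 < mu - 1 := by nlinarith
    rw [lt_div_iff₀ hmu] at ha2
    linarith

theorem solNum_mul_lt (hQ : Q lam mu b c) (ha : a ∈ Ioo (b - b * lam) (d lam mu b c)) :
    solNum lam a b * (1 - lam * mu) < lam * solDen lam mu a b c := by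
  have ha3 := lt_of_mem_Ioo hQ ha
  have : 0 < (1 - lam) * (b - c * lam - a) := mul_pos (by linarith [hQ.2.1]) (by linarith)
  unfold solNum solDen
  nlinarith

theorem aExpr_mem_Ioo (hQ : Q lam mu b c) (hs0 : 0 < s) (hs : 0 < 1 + (mu - 1) * s)
    (hs' : lam * mu < 1 → s * (1 - lam * mu) < lam) :
    aExpr lam mu b c s ∈ Ioo (b - b * lam) (d lam mu b c) := by
  obtain ⟨hl0, hl1, hm, hc, hcb, hb, -⟩ := hQ
  have h1 : 0 < (1 - lam) * (b - c) := mul_pos (by linarith) (by linarith)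
  unfold aExpr
  constructor
  · rw [lt_div_iff₀ hs]
    nlinarith [mul_pos h1 hs0]
  · rw [div_lt_iff₀ hs]
    unfold d
    split_ifs with hlm
    · have := mul_pos (sub_pos.2 hcb) (sub_pos.2 (hs' hlm))
      nlinarith
    · push Not at hlm
      have hmu : 0 < mu - 1 := by nlinarith
      rw [div_mul_eq_mul_div, lt_div_iff₀ hmu]
      nlinarith

/-! ### The conjugation to a rotation -/

/-- The series `U(y) = ∑ λ^⌊(n + y)/ρ⌋ μ^n`. The translations of `y` by `ρ` and by `1` turn it
into affine functions of itself, with slopes `λ` and `1 / μ`. -/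
noncomputable def rotSum (lam mu rho y : ℝ) : ℝ := expSum lam mu fun n => ⌊((n : ℝ) + y) / rho⌋

theorem Admissible.rotSum_add_self (h : Admissible lam mu rho) (y : ℝ) :
    rotSum lam mu rho (y + rho) = lam * rotSum lam mu rho y := by
  have hr := h.rho_pos.ne'
  have h1 : ∀ n : ℕ, ⌊((n : ℝ) + (y + rho)) / rho⌋ = ⌊((n : ℝ) + y) / rho⌋ + 1 := fun n => by
    rw [← Int.floor_add_one, ← add_assoc, add_div _ rho, div_self hr]
  unfold rotSum expSum
  rw [← tsum_mul_left]
  refine tsum_congr fun n => ?_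
  simp only [h1]
  rw [zpow_add_one₀ h.lam_pos.ne']
  ring

theorem Admissible.rotSum_eq_add_mul (h : Admissible lam mu rho) {y : ℝ} (hy : 0 ≤ y) :
    rotSum lam mu rho y = lam ^ ⌊y / rho⌋ + mu * rotSum lam mu rho (y + 1) := by
  have hs := h.summable (le_floor_add_div h.rho_pos hy)
  unfold rotSum expSum
  rw [hs.tsum_eq_zero_add, ← tsum_mul_left]
  congr 1
  · simp
  · refine tsum_congr fun n => ?_
    push_cast
    rw [add_right_comm, add_assoc (n : ℝ) y, pow_succ]
    ring

theorem Admissible.rotSum_anti (h : Admissible lam mu rho) {y z : ℝ} (hy : 0 ≤ y) (hyz : y ≤ z) :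
    rotSum lam mu rho z ≤ rotSum lam mu rho y := by
  have := h.rho_pos
  exact expSum_le h.lam_pos h.lam_lt h.mu_pos (fun n => Int.floor_le_floor (by gcongr))
    (h.summable (le_floor_add_div h.rho_pos hy))

theorem Admissible.rotSum_zero (h : Admissible lam mu rho) :
    rotSum lam mu rho 0 = 1 + mu * expSum lam mu (jumpLeft rho) := by
  rw [h.rotSum_eq_add_mul le_rfl]
  rw [zero_div, Int.floor_zero, zpow_zero, zero_add]
  rfl

/-- The value `σ(ρ)` is a lower bound for `U` on `[0, 1)`; it is the left limit of `U` at `1`. -/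
theorem Admissible.sigma_le_rotSum (h : Admissible lam mu rho) {y : ℝ} (hy : 0 ≤ y) (hy1 : y < 1) :
    expSum lam mu (jump rho) ≤ rotSum lam mu rho y := by
  have hr := h.rho_pos
  refine expSum_le h.lam_pos h.lam_lt h.mu_pos (fun n => ?_)
    (h.summable (le_floor_add_div h.rho_pos hy))
  have h1 : ((n : ℝ) + y) / rho < ((n : ℝ) + 1) / rho := by gcongr
  have : ⌊((n : ℝ) + y) / rho⌋ < ⌈((n : ℝ) + 1) / rho⌉ :=
    Int.lt_ceil.2 ((Int.floor_le _).trans_lt h1)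
  unfold jump
  omega

/-- The function on `[0, 1)` that sends the rotation by `ρ` to the map `f` with `b = 1`, `c = 0`:
it maps `[0, 1 - ρ)` to the branch of slope `λ` and `[1 - ρ, 1)` to the branch of slope `λμ`. -/
noncomputable def conj (lam mu a rho y : ℝ) : ℝ :=
  (a - solDen lam mu a 1 0 * rotSum lam mu rho y) / (1 - lam)

theorem Admissible.conj_add (h : Admissible lam mu rho) (y : ℝ) :
    conj lam mu a rho (y + rho) = lam * conj lam mu a rho y + a := by
  have : 1 - lam ≠ 0 := by linarith [h.lam_lt]
  unfold conj
  rw [h.rotSum_add_self]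
  field_simp
  ring

theorem eta_eq (hl : 0 < lam) : lam * eta lam a b = b - a := by
  unfold eta; field_simp

theorem Admissible.conj_add_sub_one (h : Admissible lam mu rho) {y : ℝ} (hy : y < 1)
    (hy1 : 1 ≤ y + rho) :
    conj lam mu a rho (y + rho - 1) = lam * mu * (conj lam mu a rho y - eta lam a 1) := by
  have h1l : 1 - lam ≠ 0 := by linarith [h.lam_lt]
  have hr := h.rho_pos
  have h1 := h.rotSum_eq_add_mul (sub_nonneg.2 hy1)
  have h2 : ⌊(y + rho - 1) / rho⌋ = 0 := by
    rw [Int.floor_eq_iff]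
    push_cast
    exact ⟨div_nonneg (by linarith) hr.le, by rw [zero_add, div_lt_one hr]; linarith⟩
  rw [h2, zpow_zero, sub_add_cancel, h.rotSum_add_self] at h1
  have h3 : lam * mu * (conj lam mu a rho y - eta lam a 1) =
      lam * mu * conj lam mu a rho y - mu * (1 - a) := by
    linear_combination (-mu) * eta_eq (a := a) (b := 1) h.lam_pos
  rw [h3]
  unfold conj
  rw [h1]
  unfold solDen
  field_simp
  ring

/-- The conditions `σ(ρ⁻) ≤ s ≤ σ(ρ)` on the solution `s` of `aExpr s = a` say that the
conjugating function takes its values in `[0, 1]`. -/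
theorem Admissible.conj_mem_Icc (h : Admissible lam mu rho) (hD : 0 < solDen lam mu a 1 0)
    (hlow : expSum lam mu (jumpLeft rho) * solDen lam mu a 1 0 ≤ solNum lam a 1)
    (hupp : solNum lam a 1 ≤ expSum lam mu (jump rho) * solDen lam mu a 1 0)
    {y : ℝ} (hy : y ∈ Ico (0 : ℝ) 1) : conj lam mu a rho y ∈ Icc (0 : ℝ) 1 := by
  have h1l : 0 < 1 - lam := by linarith [h.lam_lt]
  have h1 := h.rotSum_anti le_rfl hy.1
  have h2 := h.sigma_le_rotSum hy.1 hy.2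
  rw [h.rotSum_zero] at h1
  have h3 := mul_le_mul_of_nonneg_left h1 hD.le
  have h4 := mul_le_mul_of_nonneg_left h2 hD.le
  have h5 := mul_le_mul_of_nonneg_left hlow h.mu_pos.le
  have h6 : a - solDen lam mu a 1 0 = mu * solNum lam a 1 := by
    unfold solDen solNum; ring
  unfold conj
  constructor
  · exact div_nonneg (by linarith) h1l.le
  · rw [div_le_one h1l]
    have : solNum lam a 1 = a - (1 - lam) := by unfold solNum; ring
    linarith

/-! ### The lift -/

theorem lift_add_intCast (lam mu a b c x : ℝ) (m : ℤ) :
    lift lam mu a b c (x + m) = lift lam mu a b c x + m := by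
  unfold lift
  simp only [Int.fract_add_intCast, Int.floor_add_intCast, Int.cast_add]
  split_ifs <;> ring

theorem lift_of_lt_eta {x : ℝ} (hx : x ∈ Ico (0 : ℝ) 1) (h : x < eta lam a b) :
    lift lam mu a b c x = lam * x + a := by
  have h0 : ⌊x⌋ = 0 := Int.floor_eq_zero_iff.2 hx
  have h1 : Int.fract x = x := Int.fract_eq_self.2 hx
  simp [lift, h0, h1, h]

theorem lift_of_eta_le {x : ℝ} (hx : x ∈ Ico (0 : ℝ) 1) (h : eta lam a b ≤ x) :
    lift lam mu a b c x = lam * mu * (x - eta lam a b) + c + 1 := by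
  have h0 : ⌊x⌋ = 0 := Int.floor_eq_zero_iff.2 hx
  have h1 : Int.fract x = x := Int.fract_eq_self.2 hx
  simp [lift, h0, h1, not_lt.2 h]

/-- The parameters with `b = 1` and `c = 0` for which the lift is increasing on the whole line. -/
structure Normal (lam mu a : ℝ) : Prop where
  lam_pos : 0 < lam
  lam_lt : lam < 1
  mu_pos : 0 < mu
  lt_a : 1 - lam < a
  a_lt : a < 1
  den_pos : 0 < solDen lam mu a 1 0

theorem Normal.eta_mem (h : Normal lam mu a) : eta lam a 1 ∈ Ioo (0 : ℝ) 1 := by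
  have h1 := h.lt_a
  have h2 := h.a_lt
  unfold eta
  exact ⟨div_pos (by linarith) h.lam_pos, by rw [div_lt_one h.lam_pos]; linarith⟩

/-- The gap between the end of the second branch and the start of the first one. -/
theorem Normal.lt_add_one (h : Normal lam mu a) : lam * mu * (1 - eta lam a 1) < a := by
  have h1 := eta_eq (a := a) (b := 1) h.lam_pos
  have h2 : lam * mu * (1 - eta lam a 1) = lam * mu - mu * (1 - a) := by rw [← h1]; ring
  have h3 := h.den_pos
  unfold solDen at h3
  linarith

theorem Normal.lift_mem (h : Normal lam mu a) {x : ℝ} (hx : x ∈ Ico (0 : ℝ) 1) :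
    lift lam mu a 1 0 x ∈ Ico a (1 + a) := by
  have h1 := eta_eq (a := a) (b := 1) h.lam_pos
  have h2 := h.a_lt
  have hl := h.lam_pos
  have hm := h.mu_pos
  rcases lt_or_ge x (eta lam a 1) with hlt | hge
  · rw [lift_of_lt_eta hx hlt]
    have h3 := mul_lt_mul_of_pos_left hlt h.lam_pos
    have h4 := mul_nonneg hl.le hx.1
    have := h.lt_a
    have := h.lam_lt
    exact ⟨by linarith, by linarith⟩
  · rw [lift_of_eta_le hx hge]
    have h3 : lam * mu * (x - eta lam a 1) ≤ lam * mu * (1 - eta lam a 1) := by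
      gcongr
      exact hx.2.le
    have h4 : 0 ≤ lam * mu * (x - eta lam a 1) := mul_nonneg (by positivity) (by linarith)
    have := h.lt_add_one
    exact ⟨by linarith, by linarith⟩

theorem Normal.lift_lt_lift_of_mem (h : Normal lam mu a) {x y : ℝ} (hx : 0 ≤ x) (hxy : x < y)
    (hy : y < 1) : lift lam mu a 1 0 x < lift lam mu a 1 0 y := by
  have hx' : x ∈ Ico (0 : ℝ) 1 := ⟨hx, hxy.trans hy⟩
  have hy' : y ∈ Ico (0 : ℝ) 1 := ⟨hx.trans hxy.le, hy⟩
  have h1 := eta_eq (a := a) (b := 1) h.lam_pos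
  have hl := h.lam_pos
  have hm := h.mu_pos
  rcases lt_or_ge y (eta lam a 1) with hy1 | hy1
  · rw [lift_of_lt_eta hx' (hxy.trans hy1), lift_of_lt_eta hy' hy1]
    gcongr
  · rw [lift_of_eta_le hy' hy1]
    have h4 : 0 ≤ lam * mu * (y - eta lam a 1) := mul_nonneg (by positivity) (by linarith)
    rcases lt_or_ge x (eta lam a 1) with hx1 | hx1
    · rw [lift_of_lt_eta hx' hx1]
      have h3 := mul_lt_mul_of_pos_left hx1 h.lam_pos
      linarith
    · rw [lift_of_eta_le hx' hx1]
      gcongr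

theorem Normal.strictMono_lift (h : Normal lam mu a) : StrictMono (lift lam mu a 1 0) := by
  intro x y hxy
  have hfx : Int.fract x ∈ Ico (0 : ℝ) 1 := ⟨Int.fract_nonneg x, Int.fract_lt_one x⟩
  have hfy : Int.fract y ∈ Ico (0 : ℝ) 1 := ⟨Int.fract_nonneg y, Int.fract_lt_one y⟩
  have hx := Int.fract_add_floor x
  have hy := Int.fract_add_floor y
  rw [← hx, ← hy, lift_add_intCast, lift_add_intCast]
  rcases (Int.floor_le_floor hxy.le).eq_or_lt with heq | hlt
  · rw [heq] at hx ⊢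
    have := h.lift_lt_lift_of_mem hfx.1 (by linarith : Int.fract x < Int.fract y) hfy.2
    linarith
  · have h1 : ((⌊x⌋ : ℝ)) + 1 ≤ ⌊y⌋ := by exact_mod_cast hlt
    have := (h.lift_mem hfx).2
    have := (h.lift_mem hfy).1
    linarith

/-- On `[0, η]` both one-sided comparisons with the first branch hold. -/
theorem Normal.lift_compare_left (h : Normal lam mu a) {w : ℝ} (hw : 0 ≤ w)
    (hw1 : w ≤ eta lam a 1) (x : ℝ) :
    (x < w → lift lam mu a 1 0 x < lam * w + a) ∧ (w < x → lam * w + a < lift lam mu a 1 0 x) := by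
  have hmem : w ∈ Ico (0 : ℝ) 1 := ⟨hw, hw1.trans_lt h.eta_mem.2⟩
  have heq : lift lam mu a 1 0 w = lam * w + a := by
    rcases hw1.eq_or_lt with he | hlt
    · rw [lift_of_eta_le hmem he.ge, he, eta_eq h.lam_pos]
      ring
    · exact lift_of_lt_eta hmem hlt
  rw [← heq]
  exact ⟨fun hx => h.strictMono_lift hx, fun hx => h.strictMono_lift hx⟩

/-- On `[η, 1]` both one-sided comparisons with the second branch hold, although the lift is
discontinuous at `1`. -/
theorem Normal.lift_compare_right (h : Normal lam mu a) {w : ℝ} (hw : eta lam a 1 ≤ w)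
    (hw1 : w ≤ 1) (x : ℝ) :
    (x < w → lift lam mu a 1 0 x < lam * mu * (w - eta lam a 1) + 1) ∧
      (w < x → lam * mu * (w - eta lam a 1) + 1 < lift lam mu a 1 0 x) := by
  obtain ⟨he0, he1⟩ := h.eta_mem
  have hl := h.lam_pos
  have hm := h.mu_pos
  rcases hw1.lt_or_eq with hlt | rfl
  · have hmem : w ∈ Ico (0 : ℝ) 1 := ⟨he0.le.trans hw, hlt⟩
    have heq := lift_of_eta_le (c := 0) (mu := mu) hmem hw
    rw [add_zero] at heq
    rw [← heq]
    exact ⟨fun hx => h.strictMono_lift hx, fun hx => h.strictMono_lift hx⟩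
  · constructor
    · intro hx
      have hmax : max x (eta lam a 1) < 1 := max_lt hx he1
      have h1 := h.strictMono_lift.monotone (le_max_left x (eta lam a 1))
      rw [lift_of_eta_le ⟨he0.le.trans (le_max_right _ _), hmax⟩ (le_max_right _ _), add_zero] at h1
      refine h1.trans_lt ?_
      gcongr
    · intro hx
      have h1 := h.strictMono_lift hx
      have h2 : lift lam mu a 1 0 1 = 1 + a := by
        have h3 := lift_add_one lam mu a 1 0 0
        rw [lift_of_lt_eta ⟨le_rfl, one_pos⟩ he0] at h3
        rw [zero_add] at h3
        linarith
      have := h.lt_add_one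
      linarith

/-- The conjugating function on the line, which commutes with the integer translations. -/
noncomputable def conjLine (lam mu a rho y : ℝ) : ℝ := ⌊y⌋ + conj lam mu a rho (Int.fract y)

/-- The hypotheses under which `conjLine` compares orbits of the lift with the rotation by `ρ`:
`a` is normalised and the solution `s` of `aExpr s = a` satisfies `σ(ρ⁻) ≤ s ≤ σ(ρ)`. -/
structure Matches (lam mu a rho : ℝ) : Prop extends Normal lam mu a where
  adm : Admissible lam mu rho
  rho_lt : rho < 1
  low : expSum lam mu (jumpLeft rho) * solDen lam mu a 1 0 ≤ solNum lam a 1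
  upp : solNum lam a 1 ≤ expSum lam mu (jump rho) * solDen lam mu a 1 0

theorem Matches.conj_mem (h : Matches lam mu a rho) (y : ℝ) :
    conj lam mu a rho (Int.fract y) ∈ Icc (0 : ℝ) 1 :=
  h.adm.conj_mem_Icc h.den_pos h.low h.upp ⟨Int.fract_nonneg y, Int.fract_lt_one y⟩

/-- Strict inequalities with `conjLine` are preserved by a step of the lift and of the rotation.
For `s = σ(ρ)` with `ρ` rational, the function `conj` takes the value `1`, where the lift has the
wrong one-sided value: the image of the rotation is not an orbit, but the strict inequalities still
hold. -/
theorem Matches.step (h : Matches lam mu a rho) (x y : ℝ) :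
    (x < conjLine lam mu a rho y → lift lam mu a 1 0 x < conjLine lam mu a rho (y + rho)) ∧
      (conjLine lam mu a rho y < x → conjLine lam mu a rho (y + rho) < lift lam mu a 1 0 x) := by
  have hl := h.lam_pos
  have hm := h.mu_pos
  have hlm : 0 < lam * mu := mul_pos hl hm
  have hr := h.adm.rho_pos
  have hr1 := h.rho_lt
  have he := eta_eq (a := a) (b := 1) hl
  have hy := Int.fract_add_floor y
  have hy0 := Int.fract_nonneg y
  have hy1 := Int.fract_lt_one y
  have hc := h.conj_mem y
  have hc' := h.conj_mem (y + rho)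
  have hx : lift lam mu a 1 0 x = lift lam mu a 1 0 (x - ⌊y⌋) + ⌊y⌋ := by
    rw [← lift_add_intCast, sub_add_cancel]
  rw [hx]
  unfold conjLine
  rcases lt_or_ge (Int.fract y + rho) 1 with hlt | hge
  · have h1 : ⌊y + rho⌋ = ⌊y⌋ := by
      rw [Int.floor_eq_iff]
      constructor <;> linarith
    have h2 : Int.fract (y + rho) = Int.fract y + rho := by
      rw [Int.fract, h1]; linarith
    rw [h2, h.adm.conj_add] at hc' ⊢
    rw [h1]
    have hle : conj lam mu a rho (Int.fract y) ≤ eta lam a 1 := by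
      refine le_of_mul_le_mul_left ?_ hl
      linarith [hc'.2]
    obtain ⟨c1, c2⟩ := h.toNormal.lift_compare_left hc.1 hle (x - ⌊y⌋)
    exact ⟨fun hxy => by linarith [c1 (by linarith)], fun hxy => by linarith [c2 (by linarith)]⟩
  · have h1 : ⌊y + rho⌋ = ⌊y⌋ + 1 := by
      rw [Int.floor_eq_iff]
      push_cast
      constructor <;> linarith
    have h2 : Int.fract (y + rho) = Int.fract y + rho - 1 := by
      rw [Int.fract, h1]; push_cast; linarith
    rw [h2, h.adm.conj_add_sub_one hy1 hge] at hc' ⊢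
    rw [h1]
    push_cast
    have hle : eta lam a 1 ≤ conj lam mu a rho (Int.fract y) := by
      have := nonneg_of_mul_nonneg_right hc'.1 hlm
      linarith
    obtain ⟨c1, c2⟩ := h.toNormal.lift_compare_right hle hc.2 (x - ⌊y⌋)
    exact ⟨fun hxy => by linarith [c1 (by linarith)], fun hxy => by linarith [c2 (by linarith)]⟩

theorem Matches.iterate (h : Matches lam mu a rho) (x y : ℝ) (n : ℕ) :
    (x < conjLine lam mu a rho y →
      (lift lam mu a 1 0)^[n] x < conjLine lam mu a rho (y + n * rho)) ∧
      (conjLine lam mu a rho y < x →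
        conjLine lam mu a rho (y + n * rho) < (lift lam mu a 1 0)^[n] x) := by
  induction n with
  | zero => simp
  | succ n ih =>
    have h1 : y + ((n + 1 : ℕ) : ℝ) * rho = y + n * rho + rho := by push_cast; ring
    rw [Function.iterate_succ_apply', h1]
    exact ⟨fun hxy => (h.step _ _).1 (ih.1 hxy), fun hxy => (h.step _ _).2 (ih.2 hxy)⟩

/-- The orbits of the normalised lift stay at bounded distance from those of the rotation. -/
theorem Matches.abs_iterate_sub_le (h : Matches lam mu a rho) (x : ℝ) (n : ℕ) :
    |(lift lam mu a 1 0)^[n] x - (x + n * rho)| ≤ 3 := by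
  have hb : ∀ y, conjLine lam mu a rho y ∈ Icc (y - 1) (y + 1) := fun y => by
    have h1 := h.conj_mem y
    have h2 := Int.floor_le y
    have h3 := Int.lt_floor_add_one y
    unfold conjLine
    exact ⟨by linarith [h1.1], by linarith [h1.2]⟩
  have h1 := (h.iterate x (x + 2) n).1 (by linarith [(hb (x + 2)).1])
  have h2 := (h.iterate x (x - 2) n).2 (by linarith [(hb (x - 2)).2])
  rw [abs_le]
  constructor
  · linarith [(hb (x - 2 + n * rho)).1]
  · linarith [(hb (x + 2 + n * rho)).2]

/-! ### Reduction to `b = 1`, `c = 0` -/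

/-- The parameter `a` in the coordinate that maps `[c, b)` to `[0, 1)`. -/
noncomputable def normA (lam a b c : ℝ) : ℝ := (a - (1 - lam) * c) / (b - c)

/-- The coordinate on the line that maps each `[m + c, m + b)` affinely to `[m, m + 1)`. -/
noncomputable def normX (b c x : ℝ) : ℝ := ⌊x⌋ + (Int.fract x - c) / (b - c)

theorem solNum_normA (hcb : c < b) : solNum lam (normA lam a b c) 1 = solNum lam a b / (b - c) := by
  have : b - c ≠ 0 := by linarith
  unfold solNum normA
  field_simp
  ring

theorem solDen_normA (hcb : c < b) :
    solDen lam mu (normA lam a b c) 1 0 = solDen lam mu a b c / (b - c) := by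
  have : b - c ≠ 0 := by linarith
  unfold solDen normA
  field_simp
  ring

theorem normal_normA (hQ : Q lam mu b c) (ha : a ∈ Ioo (b - b * lam) (d lam mu b c)) :
    Normal lam mu (normA lam a b c) := by
  have h1 := lt_of_mem_Ioo hQ ha
  have h2 := solDen_pos hQ ha
  obtain ⟨hl0, hl1, hm, hc, hcb, hb, -⟩ := hQ
  have hbc : 0 < b - c := by linarith
  refine ⟨hl0, hl1, hm, ?_, ?_, ?_⟩
  · unfold normA
    rw [lt_div_iff₀ hbc]
    linarith [ha.1]
  · unfold normA
    rw [div_lt_one hbc]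
    linarith
  · rw [solDen_normA hcb]
    positivity

theorem eta_normA (hl : 0 < lam) (hcb : c < b) :
    eta lam (normA lam a b c) 1 = (eta lam a b - c) / (b - c) := by
  have : b - c ≠ 0 := by linarith
  unfold eta normA
  field_simp
  ring

/-- On the points with fractional part in `[c, b)`, which the lift preserves, the coordinate
`normX` conjugates the lift with the normalised one. -/
theorem normX_lift (hQ : Q lam mu b c) (ha : a ∈ Ioo (b - b * lam) (d lam mu b c)) {x : ℝ}
    (hx : Int.fract x ∈ Ico c b) :
    Int.fract (lift lam mu a b c x) ∈ Ico c b ∧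
      normX b c (lift lam mu a b c x) = lift lam mu (normA lam a b c) 1 0 (normX b c x) := by
  have hfr := fract_lift hQ ha x
  have h1 := lt_of_mem_Ioo hQ ha
  have h2 := solDen_pos hQ ha
  have ha1 := ha.1
  have hf := f_mem_Ico hQ ha (x := Int.fract x) ⟨Int.fract_nonneg x, Int.fract_lt_one x⟩
  obtain ⟨hl0, hl1, hm, hc, hcb, hb, -⟩ := hQ
  have hbc : 0 < b - c := by linarith
  have hlm : 0 < lam * mu := mul_pos hl0 hm
  have he := eta_eq (a := a) (b := b) hl0
  have hmem : (Int.fract x - c) / (b - c) ∈ Ico (0 : ℝ) 1 :=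
    ⟨div_nonneg (by linarith [hx.1]) hbc.le, by rw [div_lt_one hbc]; linarith [hx.2]⟩
  have hG : lift lam mu (normA lam a b c) 1 0 (normX b c x) =
      lift lam mu (normA lam a b c) 1 0 ((Int.fract x - c) / (b - c)) + ⌊x⌋ := by
    unfold normX
    rw [add_comm, lift_add_intCast]
  have hdec := Int.fract_add_floor (lift lam mu a b c x)
  rw [hG]
  unfold normX
  rw [hfr] at hdec ⊢
  rcases lt_or_ge (Int.fract x) (eta lam a b) with hlt | hge
  · have hfx : f lam mu a b c (Int.fract x) = lam * Int.fract x + a := if_pos hlt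
    have hLx : lift lam mu a b c x = lam * x + a + (1 - lam) * ⌊x⌋ := if_pos hlt
    have hfl : (⌊lift lam mu a b c x⌋ : ℝ) = ⌊x⌋ := by
      rw [hfx, hLx] at hdec
      rw [hLx]
      have := Int.fract_add_floor x
      nlinarith
    rw [hfx, hfl, lift_of_lt_eta hmem (by rw [eta_normA hl0 hcb]; gcongr)]
    refine ⟨⟨?_, ?_⟩, ?_⟩
    · have := mul_le_mul_of_nonneg_left hx.1 hl0.le
      nlinarith
    · have := mul_lt_mul_of_pos_left hlt hl0
      linarith
    · unfold normA
      field_simp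
      ring
  · have hfx : f lam mu a b c (Int.fract x) = lam * mu * (Int.fract x - eta lam a b) + c :=
      if_neg (not_lt.2 hge)
    have hLx : lift lam mu a b c x =
        lam * mu * (x - eta lam a b) + c + 1 + (1 - lam * mu) * ⌊x⌋ := if_neg (not_lt.2 hge)
    have hfl : (⌊lift lam mu a b c x⌋ : ℝ) = ⌊x⌋ + 1 := by
      rw [hfx, hLx] at hdec
      rw [hLx]
      have : x = Int.fract x + ⌊x⌋ := (Int.fract_add_floor x).symm
      have h5 : lam * mu * (x - eta lam a b) =
        lam * mu * (Int.fract x - eta lam a b) + lam * mu * ⌊x⌋ := by nth_rw 1 [this]; ring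
      linarith
    rw [hfx, hfl, lift_of_eta_le hmem (by rw [eta_normA hl0 hcb]; gcongr), eta_normA hl0 hcb]
    refine ⟨⟨?_, ?_⟩, ?_⟩
    · have : 0 ≤ lam * mu * (Int.fract x - eta lam a b) := mul_nonneg hlm.le (by linarith)
      linarith
    · have h6 := mul_lt_mul_of_pos_left hx.2 hlm
      have h7 : lam * mu * (Int.fract x - eta lam a b) =
        lam * mu * Int.fract x - mu * (b - a) := by rw [← he]; ring
      unfold solDen at h2
      linarith
    · field_simp
      ring

/-! ### Orbits enter the invariant region -/

theorem exists_iterate_not_of_le_sub {g : ℝ → ℝ} {P : ℝ → Prop} {δ m : ℝ} (hδ : 0 < δ)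
    (hm : ∀ x, P x → m ≤ x) (hg : ∀ x, P x → g x ≤ x - δ) (x : ℝ) : ∃ n, ¬P (g^[n] x) := by
  by_contra! hcon
  have h1 : ∀ n : ℕ, g^[n] x ≤ x - n * δ := fun n => by
    induction n with
    | zero => simp
    | succ n ih =>
      rw [Function.iterate_succ_apply']
      push_cast
      linarith [hg _ (hcon n)]
  obtain ⟨n, hn⟩ := exists_nat_gt ((x - m) / δ)
  rw [div_lt_iff₀ hδ] at hn
  linarith [h1 n, hm _ (hcon n)]

/-- Below `c` the map `f` moves points up, and above `b` down, by amounts bounded away from `0`. -/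
theorem exists_f_sub_le (hQ : Q lam mu b c) (ha : a ∈ Ioo (b - b * lam) (d lam mu b c)) :
    ∃ δ > 0, (∀ x ∈ Ico 0 c, x + δ ≤ f lam mu a b c x ∧ f lam mu a b c x < b) ∧
      ∀ x ∈ Ico b 1, f lam mu a b c x ≤ x - δ ∧ c ≤ f lam mu a b c x := by
  have h1 := lt_of_mem_Ioo hQ ha
  have h2 := solDen_pos hQ ha
  obtain ⟨ha1, -⟩ := ha
  obtain ⟨hl0, hl1, hm, hc, hcb, hb, hor⟩ := hQ
  have hlm : 0 < lam * mu := mul_pos hl0 hm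
  have he := eta_eq (a := a) (b := b) hl0
  have hce : c < eta lam a b := by
    refine lt_of_mul_lt_mul_left ?_ hl0.le
    linarith
  have heb : eta lam a b < b := by
    refine lt_of_mul_lt_mul_left ?_ hl0.le
    linarith
  have hleft : ∀ x ∈ Ico 0 c, x + (b - c) * (1 - lam) ≤ f lam mu a b c x ∧
      f lam mu a b c x < b := fun x hx => by
    have hx1 := hx.2.trans hce
    have hfx : f lam mu a b c x = lam * x + a := if_pos hx1
    rw [hfx]
    constructor
    · have := mul_lt_mul_of_pos_left hx.2 (by linarith : 0 < 1 - lam)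
      nlinarith
    · have := mul_lt_mul_of_pos_left hx1 hl0
      linarith
  have hright : ∀ x ∈ Ico b 1, f lam mu a b c x = lam * mu * x - mu * (b - a) + c ∧
      c ≤ f lam mu a b c x := fun x hx => by
    have hx1 : eta lam a b ≤ x := heb.le.trans hx.1
    have hfx : f lam mu a b c x = lam * mu * (x - eta lam a b) + c := if_neg (not_lt.2 hx1)
    rw [hfx]
    constructor
    · rw [← he]; ring
    · have : 0 ≤ lam * mu * (x - eta lam a b) := mul_nonneg hlm.le (by linarith)
      linarith
  have hpos : 0 < (b - c) * (1 - lam) := mul_pos (by linarith) (by linarith)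
  unfold solDen at h2
  -- `f(x) - x` is affine on `[b, 1)`; its largest value is at `b` if `λμ ≤ 1`, and at `1` otherwise
  rcases le_or_gt (lam * mu) 1 with hle | hgt
  · have hδ : 0 < b - (lam * mu * b - mu * (b - a) + c) := by nlinarith
    refine ⟨min ((b - c) * (1 - lam)) (b - (lam * mu * b - mu * (b - a) + c)), lt_min hpos hδ,
      fun x hx => ⟨?_, (hleft x hx).2⟩, fun x hx => ⟨?_, (hright x hx).2⟩⟩
    · linarith [(hleft x hx).1, min_le_left ((b - c) * (1 - lam))
        (b - (lam * mu * b - mu * (b - a) + c))]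
    · have h3 := min_le_right ((b - c) * (1 - lam)) (b - (lam * mu * b - mu * (b - a) + c))
      have h4 : 0 ≤ (1 - lam * mu) * (x - b) := mul_nonneg (by linarith) (by linarith [hx.1])
      rw [(hright x hx).1]
      linarith
  · have hmu : 0 < mu - 1 := by nlinarith
    have hδ : 0 < 1 - (lam * mu - mu * (b - a) + c) := by
      have h4 : 0 ≤ (lam * mu - 1) * ((mu * b - c) - (mu - 1)) :=
        mul_nonneg (by linarith) (by rcases hor with h | h <;> linarith)
      have h5 := mul_lt_mul_of_pos_left h2 hm
      refine pos_of_mul_pos_right (a := mu - 1) ?_ hmu.le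
      nlinarith
    refine ⟨min ((b - c) * (1 - lam)) (1 - (lam * mu - mu * (b - a) + c)), lt_min hpos hδ,
      fun x hx => ⟨?_, (hleft x hx).2⟩, fun x hx => ⟨?_, (hright x hx).2⟩⟩
    · linarith [(hleft x hx).1, min_le_left ((b - c) * (1 - lam))
        (1 - (lam * mu - mu * (b - a) + c))]
    · have h3 := min_le_right ((b - c) * (1 - lam)) (1 - (lam * mu - mu * (b - a) + c))
      have h4 : 0 ≤ (lam * mu - 1) * (1 - x) := mul_nonneg (by linarith) (by linarith [hx.2])
      rw [(hright x hx).1]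
      linarith

theorem exists_iterate_f_mem (hQ : Q lam mu b c) (ha : a ∈ Ioo (b - b * lam) (d lam mu b c))
    {x : ℝ} (hx : x ∈ Ico (0 : ℝ) 1) : ∃ n, (f lam mu a b c)^[n] x ∈ Ico c b := by
  obtain ⟨δ, hδ, hlow, hupp⟩ := exists_f_sub_le hQ ha
  obtain ⟨-, -, -, hc, hcb, hb, -⟩ := id hQ
  -- points above `b` descend into the region, since they cannot jump below `c`
  have hdown : ∀ y ∈ Ico b 1, ∃ n, (f lam mu a b c)^[n] y ∈ Ico c b := fun y hy => by
    by_contra! hcon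
    have hmem : ∀ n, (f lam mu a b c)^[n] y ∈ Ico b 1 := fun n => by
      induction n with
      | zero => exact hy
      | succ n ih =>
        have h1 := f_mem_Ico hQ ha (x := (f lam mu a b c)^[n] y) ⟨by linarith [ih.1], ih.2⟩
        have h2 := hcon (n + 1)
        rw [Function.iterate_succ_apply'] at h2 ⊢
        exact ⟨not_lt.1 fun h3 => h2 ⟨(hupp _ ih).2, h3⟩, h1.2⟩
    obtain ⟨n, hn⟩ := exists_iterate_not_of_le_sub (P := fun z => z ∈ Ico b 1) hδ
      (fun z hz => hz.1) (fun z hz => (hupp z hz).1) y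
    exact hn (hmem n)
  have hup : ∀ y ∈ Ico 0 c, ∃ n, (f lam mu a b c)^[n] y ∈ Ico c b := fun y hy => by
    by_contra! hcon
    have hmem : ∀ n, (f lam mu a b c)^[n] y ∈ Ico 0 c := fun n => by
      induction n with
      | zero => exact hy
      | succ n ih =>
        have h1 := f_mem_Ico hQ ha (x := (f lam mu a b c)^[n] y) ⟨ih.1, by linarith [ih.2]⟩
        have h2 := hcon (n + 1)
        rw [Function.iterate_succ_apply'] at h2 ⊢
        exact ⟨h1.1, not_le.1 fun h3 => h2 ⟨h3, (hlow _ ih).2⟩⟩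
    have h1 : ∀ n : ℕ, y + n * δ ≤ (f lam mu a b c)^[n] y := fun n => by
      induction n with
      | zero => simp
      | succ n ih =>
        rw [Function.iterate_succ_apply']
        push_cast
        linarith [(hlow _ (hmem n)).1]
    obtain ⟨n, hn⟩ := exists_nat_gt ((c - y) / δ)
    rw [div_lt_iff₀ hδ] at hn
    linarith [h1 n, (hmem n).2]
  rcases lt_or_ge x c with h1 | h1
  · exact hup x ⟨hx.1, h1⟩
  · rcases lt_or_ge x b with h2 | h2
    · exact ⟨0, h1, h2⟩
    · exact hdown x ⟨h2, hx.2⟩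

/-! ### Existence of the limit -/

theorem tendsto_div_of_abs_sub_le {u : ℕ → ℝ} {L K : ℝ} (N : ℕ)
    (h : ∀ n, |u (n + N) - (n + N : ℕ) * L| ≤ K) :
    Tendsto (fun n : ℕ => u n / n) atTop (𝓝 L) := by
  rw [tendsto_iff_norm_sub_tendsto_zero]
  have h1 : Tendsto (fun n : ℕ => K / n) atTop (𝓝 0) := tendsto_const_div_atTop_nhds_zero_nat K
  refine squeeze_zero' (Eventually.of_forall fun n => norm_nonneg _) ?_ h1
  filter_upwards [eventually_ge_atTop N, eventually_gt_atTop 0] with n hn hn0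
  have hpos : (0 : ℝ) < n := by exact_mod_cast hn0
  have h2 := h (n - N)
  rw [Nat.sub_add_cancel hn] at h2
  rw [Real.norm_eq_abs, le_div_iff₀ hpos, ← abs_of_pos hpos, ← abs_mul, abs_of_pos hpos, sub_mul,
    div_mul_cancel₀ _ hpos.ne', mul_comm L]
  exact h2

theorem tendsto_lift_iterate (hQ : Q lam mu b c) (ha : a ∈ Ioo (b - b * lam) (d lam mu b c))
    (hadm : Admissible lam mu rho) (hr1 : rho < 1)
    (hlow : expSum lam mu (jumpLeft rho) * solDen lam mu a b c ≤ solNum lam a b)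
    (hupp : solNum lam a b ≤ expSum lam mu (jump rho) * solDen lam mu a b c) (x : ℝ) :
    Tendsto (fun n : ℕ => ((lift lam mu a b c)^[n] x) / (n : ℝ)) atTop (𝓝 rho) := by
  have hcb : c < b := hQ.2.2.2.2.1
  have hbc : 0 < b - c := by linarith
  have hM : Matches lam mu (normA lam a b c) rho := by
    refine ⟨normal_normA hQ ha, hadm, hr1, ?_, ?_⟩
    · rw [solDen_normA hcb, solNum_normA hcb, ← mul_div_assoc]
      gcongr
    · rw [solDen_normA hcb, solNum_normA hcb, ← mul_div_assoc]
      gcongr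
  have hfr : ∀ n, Int.fract ((lift lam mu a b c)^[n] x) = (f lam mu a b c)^[n] (Int.fract x) :=
    fun n => by
      induction n with
      | zero => rfl
      | succ n ih =>
        rw [Function.iterate_succ_apply', Function.iterate_succ_apply', fract_lift hQ ha, ih]
  obtain ⟨N, hN⟩ := exists_iterate_f_mem hQ ha ⟨Int.fract_nonneg x, Int.fract_lt_one x⟩
  rw [← hfr] at hN
  set y := (lift lam mu a b c)^[N] x
  have hy : ∀ n, Int.fract ((lift lam mu a b c)^[n] y) ∈ Ico c b ∧
      normX b c ((lift lam mu a b c)^[n] y) =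
        (lift lam mu (normA lam a b c) 1 0)^[n] (normX b c y) := fun n => by
    induction n with
    | zero => exact ⟨hN, rfl⟩
    | succ n ih =>
      rw [Function.iterate_succ_apply', Function.iterate_succ_apply', ← ih.2]
      exact normX_lift hQ ha ih.1
  have hclose : ∀ z, Int.fract z ∈ Ico c b → |normX b c z - z| ≤ 1 := fun z hz => by
    have h1 : 0 ≤ (Int.fract z - c) / (b - c) := div_nonneg (by linarith [hz.1]) hbc.le
    have h2 : (Int.fract z - c) / (b - c) ≤ 1 := by
      rw [div_le_one hbc]; linarith [hz.2]
    have h3 := Int.fract_add_floor z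
    have h4 := Int.fract_nonneg z
    have h5 := Int.fract_lt_one z
    unfold normX
    rw [abs_le]
    constructor <;> linarith
  refine tendsto_div_of_abs_sub_le (K := 4 + |normX b c y - N * rho|) N fun n => ?_
  rw [Function.iterate_add_apply]
  have h1 := hclose _ (hy n).1
  have h2 := hM.abs_iterate_sub_le (normX b c y) n
  rw [← (hy n).2] at h2
  have h3 := abs_le.1 h1
  have h4 := abs_le.1 h2
  have h5 := neg_abs_le (normX b c y - N * rho)
  have h6 := le_abs_self (normX b c y - N * rho)
  push_cast
  rw [abs_le]
  constructor <;> linarith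

/-! ### The rotation number as a function of `a` -/

theorem Admissible.sigmaLeft_den_pos (h : Admissible lam mu rho) (hr1 : rho < 1) :
    0 < 1 + (mu - 1) * expSum lam mu (jumpLeft rho) :=
  one_add_mul_expSum_pos h.lam_pos h.lam_lt h.mu_pos (one_le_jumpLeft h.rho_pos hr1)
    h.summable_jumpLeft

theorem Admissible.sigma_den_pos (h : Admissible lam mu rho) (hr1 : rho < 1) :
    0 < 1 + (mu - 1) * expSum lam mu (jump rho) :=
  one_add_mul_expSum_pos h.lam_pos h.lam_lt h.mu_pos (one_le_jump h.rho_pos hr1) h.summable_jump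

theorem Q.admissible (hQ : Q lam mu b c) (hrho : rho ∈ Ioo 0 (r lam mu)) :
    Admissible lam mu rho ∧ rho < 1 :=
  Admissible.of_lt_r hQ.1 hQ.2.1 hQ.2.2.1 hrho.1 hrho.2

/-- Every `a` lies in one of the intervals `[𝐚(ρ⁻), 𝐚(ρ)]`, and the orbits of the lift then advance
by `ρ` on average. -/
theorem exists_tendsto_lift_iterate (hQ : Q lam mu b c)
    (ha : a ∈ Ioo (b - b * lam) (d lam mu b c)) :
    ∃ rho ∈ Ioo 0 (r lam mu),
      (∀ x, Tendsto (fun n : ℕ => ((lift lam mu a b c)^[n] x) / (n : ℝ)) atTop (𝓝 rho)) ∧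
      aExpr lam mu b c (expSum lam mu (jumpLeft rho)) ≤ a ∧
      a ≤ aExpr lam mu b c (expSum lam mu (jump rho)) := by
  have hN := solNum_pos ha
  have hD := solDen_pos hQ ha
  have hlt := solNum_mul_lt hQ ha
  obtain ⟨rho, hr0, hrr, h1, h2⟩ := exists_sigmaLeft_le_le_sigma hQ.1 hQ.2.1 hQ.2.2.1
    (div_pos hN hD) fun _ => by
      rw [div_mul_eq_mul_div, div_lt_iff₀ hD]
      exact hlt
  rw [le_div_iff₀ hD] at h1
  rw [div_le_iff₀ hD] at h2
  obtain ⟨hadm, hr1⟩ := hQ.admissible ⟨hr0, hrr⟩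
  exact ⟨rho, ⟨hr0, hrr⟩, tendsto_lift_iterate hQ ha hadm hr1 h1 h2,
    (aExpr_le_iff (hadm.sigmaLeft_den_pos hr1)).2 h1, (le_aExpr_iff (hadm.sigma_den_pos hr1)).2 h2⟩

theorem hasLiftLimit (hQ : Q lam mu b c) (ha : a ∈ Ioo (b - b * lam) (d lam mu b c)) :
    HasLiftLimit lam mu a b c := by
  obtain ⟨rho, -, h, -⟩ := exists_tendsto_lift_iterate hQ ha
  exact ⟨rho, h⟩

theorem rotationNumber_eq_of_tendsto (hQ : Q lam mu b c)
    (ha : a ∈ Ioo (b - b * lam) (d lam mu b c)) (hrho : rho ∈ Ioo 0 (r lam mu))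
    (h : Tendsto (fun n : ℕ => ((lift lam mu a b c)^[n] 0) / (n : ℝ)) atTop (𝓝 rho)) :
    rotationNumber lam mu a b c = rho := by
  rw [rotationNumber_eq (hasLiftLimit hQ ha) h]
  exact Int.fract_eq_self.2 ⟨hrho.1.le, (hQ.admissible hrho).2⟩

theorem rotationNumber_spec (hQ : Q lam mu b c) (ha : a ∈ Ioo (b - b * lam) (d lam mu b c)) :
    rotationNumber lam mu a b c ∈ Ioo 0 (r lam mu) ∧
      aExpr lam mu b c (expSum lam mu (jumpLeft (rotationNumber lam mu a b c))) ≤ a ∧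
      a ≤ aExpr lam mu b c (expSum lam mu (jump (rotationNumber lam mu a b c))) := by
  obtain ⟨rho, hrho, h, h1, h2⟩ := exists_tendsto_lift_iterate hQ ha
  rw [rotationNumber_eq_of_tendsto hQ ha hrho (h 0)]
  exact ⟨hrho, h1, h2⟩

theorem rotationNumber_eq_iff (hQ : Q lam mu b c) (ha : a ∈ Ioo (b - b * lam) (d lam mu b c))
    (hrho : rho ∈ Ioo 0 (r lam mu)) :
    rotationNumber lam mu a b c = rho ↔
      aExpr lam mu b c (expSum lam mu (jumpLeft rho)) ≤ a ∧
      a ≤ aExpr lam mu b c (expSum lam mu (jump rho)) := by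
  constructor
  · rintro rfl
    exact (rotationNumber_spec hQ ha).2
  · rintro ⟨h1, h2⟩
    obtain ⟨hadm, hr1⟩ := hQ.admissible hrho
    exact rotationNumber_eq_of_tendsto hQ ha hrho (tendsto_lift_iterate hQ ha hadm hr1
      ((aExpr_le_iff (hadm.sigmaLeft_den_pos hr1)).1 h1)
      ((le_aExpr_iff (hadm.sigma_den_pos hr1)).1 h2) 0)

theorem monotoneOn_rotationNumber (hQ : Q lam mu b c) :
    MonotoneOn (fun a => rotationNumber lam mu a b c) (Ioo (b - b * lam) (d lam mu b c)) := by
  intro a ha a' ha' haa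
  obtain ⟨h1, h2, -⟩ := rotationNumber_spec hQ ha
  obtain ⟨h1', -, h2'⟩ := rotationNumber_spec hQ ha'
  obtain ⟨hadm, hr⟩ := hQ.admissible h1
  obtain ⟨hadm', hr'⟩ := hQ.admissible h1'
  by_contra hcon
  have := aExpr_lt_aExpr hQ.2.1 hQ.2.2.2.2.1 (hadm'.sigma_den_pos hr') (hadm.sigmaLeft_den_pos hr)
    (hadm'.sigma_lt hadm (not_le.1 hcon))
  linarith

theorem aExpr_sigma_mem_Ioo (hQ : Q lam mu b c) (hrho : rho ∈ Ioo 0 (r lam mu)) :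
    aExpr lam mu b c (expSum lam mu (jump rho)) ∈ Ioo (b - b * lam) (d lam mu b c) := by
  obtain ⟨hadm, hr1⟩ := hQ.admissible hrho
  have hl := hadm.lam_pos
  have hm := hadm.mu_pos
  refine aExpr_mem_Ioo hQ (expSum_pos hl hm hadm.summable_jump) (hadm.sigma_den_pos hr1)
    fun hlm => ?_
  -- compare with the left limit of `σ` at `1`, which is the geometric series `λ / (1 - λμ)`
  have hadm1 : Admissible lam mu 1 := ⟨hl, hadm.lam_lt, hm, one_pos, le_rfl, by simpa using hlm⟩
  have h1 := hadm.sigma_lt hadm1 hr1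
  have h2 : expSum lam mu (jumpLeft 1) = lam * (1 - lam * mu)⁻¹ := by
    rw [← ((hasSum_geometric_of_lt_one (by positivity) hlm).mul_left lam).tsum_eq]
    refine tsum_congr fun n => ?_
    rw [jumpLeft_one, zpow_natCast, mul_pow, pow_succ]
    ring
  rwa [h2, ← div_eq_mul_inv, lt_div_iff₀ (by linarith)] at h1

theorem image_rotationNumber (hQ : Q lam mu b c) :
    (fun a => rotationNumber lam mu a b c) '' Ioo (b - b * lam) (d lam mu b c) =
      Ioo 0 (r lam mu) := by
  refine Subset.antisymm ?_ fun rho hrho => ?_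
  · rintro _ ⟨a, ha, rfl⟩
    exact (rotationNumber_spec hQ ha).1
  · have ha := aExpr_sigma_mem_Ioo hQ hrho
    obtain ⟨hadm, hr1⟩ := hQ.admissible hrho
    refine ⟨_, ha, (rotationNumber_eq_iff hQ ha hrho).2 ⟨?_, le_rfl⟩⟩
    have hD := solDen_pos hQ ha
    rw [aExpr_le_iff (hadm.sigmaLeft_den_pos hr1)]
    refine le_trans ?_ ((aExpr_le_iff (hadm.sigma_den_pos hr1)).1 le_rfl)
    gcongr
    exact expSum_le hadm.lam_pos hadm.lam_lt hadm.mu_pos (jump_le_jumpLeft rho) hadm.summable_jump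

theorem continuousOn_rotationNumber (hQ : Q lam mu b c) :
    ContinuousOn (fun a => rotationNumber lam mu a b c) (Ioo (b - b * lam) (d lam mu b c)) := by
  intro a ha
  refine (continuousAt_of_monotoneOn_of_image_mem_nhds (monotoneOn_rotationNumber hQ)
    (isOpen_Ioo.mem_nhds ha) ?_).continuousWithinAt
  rw [image_rotationNumber hQ]
  exact isOpen_Ioo.mem_nhds (rotationNumber_spec hQ ha).1

theorem jump_eq_jumpLeft_of_irrational (hrho : Irrational rho) : jump rho = jumpLeft rho := by
  funext n
  refine le_antisymm (jump_le_jumpLeft rho n) ?_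
  have h1 : Irrational (((n + 1 : ℕ) : ℝ) / rho) := hrho.natCast_div n.succ_ne_zero
  push_cast at h1
  have h2 : (⌊((n : ℝ) + 1) / rho⌋ : ℝ) < ((n : ℝ) + 1) / rho :=
    (Int.floor_le _).lt_of_ne fun h => h1.ne_int _ h.symm
  have := Int.lt_ceil.2 h2
  unfold jump jumpLeft
  omega

end AffineCircle

theorem mainTheorem1 (lam mu b c : ℝ) (hQ : AffineCircle.Q lam mu b c) :
    -- the rotation number is well defined on the whole parameter interval
    (∀ a ∈ Ioo (b - b * lam) (AffineCircle.d lam mu b c),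
      AffineCircle.HasLiftLimit lam mu a b c) ∧
    -- it is continuous, non-decreasing and onto
    ContinuousOn (fun a => AffineCircle.rotationNumber lam mu a b c)
      (Ioo (b - b * lam) (AffineCircle.d lam mu b c)) ∧
    MonotoneOn (fun a => AffineCircle.rotationNumber lam mu a b c)
      (Ioo (b - b * lam) (AffineCircle.d lam mu b c)) ∧
    (fun a => AffineCircle.rotationNumber lam mu a b c) ''
      Ioo (b - b * lam) (AffineCircle.d lam mu b c) = Ioo 0 (AffineCircle.r lam mu) ∧
    -- the series converges and the denominator does not vanish
    (∀ rho ∈ Ioo 0 (AffineCircle.r lam mu),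
      Summable (fun k : ℕ => AffineCircle.sigmaTerm lam mu rho (k + 1)) ∧
      1 + (mu - 1) * AffineCircle.sigma lam mu rho ≠ 0) ∧
    -- irrational rotation numbers
    (∀ rho ∈ Ioo 0 (AffineCircle.r lam mu), Irrational rho →
      ∀ a ∈ Ioo (b - b * lam) (AffineCircle.d lam mu b c),
        (AffineCircle.rotationNumber lam mu a b c = rho ↔
          a = AffineCircle.aFun lam mu b c rho)) ∧
    -- rational rotation numbers
    (∀ p q : ℕ, 0 < p → p < q → Nat.Coprime p q →
      (p : ℝ) / (q : ℝ) < AffineCircle.r lam mu →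
      (∀ a ∈ Ioo (b - b * lam) (AffineCircle.d lam mu b c),
        (AffineCircle.rotationNumber lam mu a b c = (p : ℝ) / (q : ℝ) ↔
          AffineCircle.aRatLeft lam mu b c p q ≤ a ∧
            a ≤ AffineCircle.aFun lam mu b c ((p : ℝ) / (q : ℝ)))) ∧
      lam ^ q * mu ^ p < 1 ∧
      AffineCircle.sigma lam mu ((p : ℝ) / (q : ℝ)) = AffineCircle.sigmaRat lam mu p q ∧
      1 + (mu - 1) * AffineCircle.sigmaRatLeft lam mu p q ≠ 0 ∧
      Tendsto (fun rho => AffineCircle.sigma lam mu rho) (𝓝[<] ((p : ℝ) / (q : ℝ)))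
        (𝓝 (AffineCircle.sigmaRatLeft lam mu p q)) ∧
      Tendsto (fun rho => AffineCircle.aFun lam mu b c rho) (𝓝[<] ((p : ℝ) / (q : ℝ)))
        (𝓝 (AffineCircle.aRatLeft lam mu b c p q))) := by 
  have hsig : ∀ rho ∈ Ioo 0 (AffineCircle.r lam mu),
      AffineCircle.sigma lam mu rho = AffineCircle.expSum lam mu (AffineCircle.jump rho) :=
    fun rho hrho => (hQ.admissible hrho).1.sigma_eq (hQ.admissible hrho).2
  refine ⟨fun a ha => AffineCircle.hasLiftLimit hQ ha, AffineCircle.continuousOn_rotationNumber hQ,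
    AffineCircle.monotoneOn_rotationNumber hQ, AffineCircle.image_rotationNumber hQ,
    fun rho hrho => ?_, fun rho hrho hirr a ha => ?_, fun p q hp hpq hcop hlt => ?_⟩
  · obtain ⟨hadm, hr1⟩ := hQ.admissible hrho
    rw [hsig rho hrho]
    exact ⟨(hadm.hasSum_sigmaTerm hr1).summable, (hadm.sigma_den_pos hr1).ne'⟩
  · rw [AffineCircle.rotationNumber_eq_iff hQ ha hrho, AffineCircle.aFun, hsig rho hrho,
      AffineCircle.jump_eq_jumpLeft_of_irrational hirr]
    exact ⟨fun h => le_antisymm h.2 h.1, fun h => ⟨h.ge, h.le⟩⟩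
  · have hq : 0 < q := hp.trans hpq
    have hrho : (p : ℝ) / q ∈ Ioo 0 (AffineCircle.r lam mu) := ⟨by positivity, hlt⟩
    obtain ⟨hadm, hr1⟩ := hQ.admissible hrho
    have hleft := hadm.sigmaRatLeft_eq hp hpq hcop
    have hden := (hadm.sigmaLeft_den_pos hr1).ne'
    have htend : Tendsto (fun rho => AffineCircle.sigma lam mu rho) (𝓝[<] ((p : ℝ) / (q : ℝ)))
        (𝓝 (AffineCircle.sigmaRatLeft lam mu p q)) := by
      rw [hleft]
      refine hadm.tendsto_left.congr' ?_
      filter_upwards [self_mem_nhdsWithin, (lt_mem_nhds hrho.1).filter_mono nhdsWithin_le_nhds]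
        with x hx hx0
      exact (hsig x ⟨hx0, lt_trans hx hlt⟩).symm
    rw [← hleft] at hden
    refine ⟨fun a ha => ?_, hadm.pow_mul_pow_lt_one hp hq, hadm.sigma_eq_sigmaRat hp hpq, hden,
      htend, AffineCircle.tendsto_aExpr hden htend⟩
    rw [AffineCircle.rotationNumber_eq_iff hQ ha hrho, AffineCircle.aFun, hsig _ hrho,
      AffineCircle.aRatLeft, hleft]
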